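/- **Proposition.** Let $\alpha>5/2$ be a real number. Let $H_o$ be the Hilbert space of odd functions in $L^2(\mathbf{R}/2\pi\mathbf{Z},\mathbf{C})$, let $\Delta=\frac{d^2}{d\theta^2}$, let $A=\mathrm{i}|\Delta|^{\alpha}$ on $H_o$ with its natural domain ($|\Delta|^\alpha$ multiplies the Fourier coefficient of index $k$ by $|k|^{2\alpha}$), and let $B$ be the multiplication by $-\mathrm{i}\cos\theta$ on $H_o$. For every real $v$, $A+vB$ generates a strongly continuous group of unitary operators $(e^{t(A+vB)})_{t\in\mathbf{R}}$. A piecewise constant control $u:[0,T]\to\mathbf{R}$ taking successively the values $v_1,\dots,v_n$ during the times $\tau_1,\dots,\tau_n>0$, with $\tau_1+\dots+\tau_n=T$, steers $\psi_0$ in time $T$ to $$\Upsilon^u_T\psi_0=e^{\tau_n(A+v_nB)}\cdots e^{\tau_1(A+v_1B)}\psi_0 ,$$ the value at time $T$ of the solution of $\mathrm{i}\,\partial_t\psi=-|\Delta|^\alpha\psi+u(t)\cos\theta\,\psi$ with $\psi(0)=\psi_0$. For $k\ge 1$ put $\phi_k(\theta)=\sin(k\theta)/\sqrt{\pi}$,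 and let $\mathcal{L}_N$ be the linear span of $\phi_1,\dots,\phi_N$. Then there is an integer $N_{\min}$, depending only on $\alpha$, such that for all integers $N_0\ge N_{\min}$ and $P\ge N_0$, for all $\psi_0,\psi_1\in\mathcal{L}_P\cap\mathcal{L}_{N_0-1}^{\perp}$ with $\|\psi_0\|=\|\psi_1\|=1$, and for every $\varepsilon>0$, there are a time $T$ with $$0<T<\frac{604}{\alpha^2\,\varepsilon\,(2\alpha-5)}\,\frac{1}{(N_0-1)^{2\alpha-4}}+\frac{2\pi}{N_0^{2\alpha}}$$ and a piecewise constant control $u:[0,T]\to\mathbf{R}$ such that $\|\Upsilon^u_T\psi_0-\psi_1\|<\varepsilon$. -/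

import Mathlib

open MeasureTheory Filter Topology
open scoped Real ENNReal

noncomputable section

namespace TorusControl

/-! ### Bilinear control systems `ψ' = (A + u(t) B) ψ` with piecewise constant controls -/

section Abstract

variable {H : Type*} [NormedAddCommGroup H] [InnerProductSpace ℂ H]

/-- `U` is the strongly continuous one-parameter group of unitary operators `U t = exp (t G)`
generated by the (possibly unbounded) operator `G`: a vector `ψ` lies in the domain of `G`, with
`G ψ = η`, exactly when `t ↦ U t ψ` is differentiable at `0` with derivative `η`. A group is
determined by its generator, so there is at most one such `U`. -/
structure IsUnitaryGroupOf (G : H →ₗ.[ℂ] H) (U : ℝ → (H ≃ₗᵢ[ℂ] H)) : Prop where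
  map_zero : ∀ ψ, U 0 ψ = ψ
  map_add : ∀ s t ψ, U (s + t) ψ = U s (U t ψ)
  continuous_orbit : ∀ ψ, Continuous fun t => U t ψ
  generator : ∀ ψ η, (ψ, η) ∈ G.graph ↔ HasDerivAt (fun t : ℝ => U t ψ) η 0

/-- `Steers A B u ψ ψ'`: the piecewise constant control `u` drives the system
`ψ' = (A + u(t) B) ψ` from `ψ` to `ψ'`. The control is given by the list of its successive pieces
`(τ, v)`: `u` takes the real value `v` during a time `τ > 0`, and then the state is multiplied by
`exp (τ (A + v B))`. -/
inductive Steers (A : H →ₗ.[ℂ] H) (B : H →ₗ[ℂ] H) : List (ℝ × ℝ) → H → H → Prop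
  | nil (ψ : H) : Steers A B [] ψ ψ
  | cons (τ v : ℝ) (u : List (ℝ × ℝ)) (ψ ψ' : H) (U : ℝ → (H ≃ₗᵢ[ℂ] H))
      (hτ : 0 < τ) (hU : IsUnitaryGroupOf (((v : ℂ) • B) +ᵥ A) U)
      (h : Steers A B u (U τ ψ) ψ') : Steers A B ((τ, v) :: u) ψ ψ'

/-- The total duration of a piecewise constant control. -/
def duration (u : List (ℝ × ℝ)) : ℝ := (u.map Prod.fst).sum

/-- The set of states that can be reached from `ψ` at time exactly `T` by means of piecewise
constant controls. -/
def reachableSet (A : H →ₗ.[ℂ] H) (B : H →ₗ[ℂ] H) (T : ℝ) (ψ : H) : Set H :=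
  {ψ' | ∃ u : List (ℝ × ℝ), duration u = T ∧ Steers A B u ψ ψ'}

end Abstract

/-! ### Odd square integrable functions on the torus -/

instance factTwoPiPos : Fact (0 < 2 * π) := ⟨Real.two_pi_pos⟩

/-- The torus `ℝ / 2πℤ`; its `volume` is the Lebesgue measure, of total mass `2π`. -/
abbrev Torus : Type := AddCircle (2 * π)

/-- `L²(ℝ / 2πℤ, ℂ)`. -/
abbrev LTwo : Type := Lp ℂ 2 (volume : Measure Torus)

/-- `cos θ`. -/
def cosT (θ : Torus) : ℝ := (fourier 1 θ : ℂ).re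

/-- `sin (k θ)`. -/
def sinT (k : ℕ) (θ : Torus) : ℝ := (fourier (k : ℤ) θ : ℂ).im

theorem cosT_coe (x : ℝ) : cosT (x : Torus) = Real.cos x := by
  have h : (2 * π * Complex.I * (1 : ℤ) * x / ((2 * π : ℝ) : ℂ) : ℂ) = x * Complex.I := by
    have : (π : ℂ) ≠ 0 := by exact_mod_cast Real.pi_ne_zero
    push_cast
    field_simp
  rw [cosT, fourier_coe_apply, h, Complex.exp_ofReal_mul_I_re]

theorem sinT_coe (k : ℕ) (x : ℝ) : sinT k (x : Torus) = Real.sin (k * x) := by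
  have h : (2 * π * Complex.I * (k : ℤ) * x / ((2 * π : ℝ) : ℂ) : ℂ)
      = ((k * x : ℝ) : ℂ) * Complex.I := by
    have : (π : ℂ) ≠ 0 := by exact_mod_cast Real.pi_ne_zero
    push_cast
    field_simp
  rw [sinT, fourier_coe_apply, h, Complex.exp_ofReal_mul_I_im]

theorem continuous_cosT : Continuous cosT :=
  Complex.continuous_re.comp (map_continuous (fourier 1))

theorem continuous_sinT (k : ℕ) : Continuous (sinT k) :=
  Complex.continuous_im.comp (map_continuous (fourier (k : ℤ)))

theorem cosT_neg (θ : Torus) : cosT (-θ) = cosT θ := by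
  induction θ using QuotientAddGroup.induction_on with
  | H x => rw [← AddCircle.coe_neg, cosT_coe, cosT_coe, Real.cos_neg]

theorem sinT_neg (k : ℕ) (θ : Torus) : sinT k (-θ) = -sinT k θ := by
  induction θ using QuotientAddGroup.induction_on with
  | H x => rw [← AddCircle.coe_neg, sinT_coe, sinT_coe, mul_neg, Real.sin_neg]

theorem abs_cosT_le (θ : Torus) : |cosT θ| ≤ 1 := by
  induction θ using QuotientAddGroup.induction_on with
  | H x => rw [cosT_coe]; exact Real.abs_cos_le_one x

theorem abs_sinT_le (k : ℕ) (θ : Torus) : |sinT k θ| ≤ 1 := by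
  induction θ using QuotientAddGroup.induction_on with
  | H x => rw [sinT_coe]; exact Real.abs_sin_le_one _

theorem ae_neg {p : Torus → Prop} (h : ∀ᵐ θ, p θ) : ∀ᵐ θ : Torus, p (-θ) :=
  (Measure.measurePreserving_neg (volume : Measure Torus)).quasiMeasurePreserving.ae h

/-- The space `H_o` of odd functions in `L²(ℝ / 2πℤ, ℂ)`. -/
def oddSubspace : Submodule ℂ LTwo where
  carrier := {f | ∀ᵐ θ : Torus, f (-θ) = -f θ}
  zero_mem' := by
    have h0 := Lp.coeFn_zero ℂ 2 (volume : Measure Torus)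
    filter_upwards [h0, ae_neg h0] with θ h1 h2
    rw [h1, h2]; simp
  add_mem' := by
    intro f g hf hg
    have h0 := Lp.coeFn_add f g
    change ∀ᵐ θ : Torus, (f + g : LTwo) (-θ) = -(f + g : LTwo) θ
    change ∀ᵐ θ : Torus, f (-θ) = -f θ at hf
    change ∀ᵐ θ : Torus, g (-θ) = -g θ at hg
    filter_upwards [h0, ae_neg h0, hf, hg] with θ h1 h2 h3 h4
    rw [h1, h2, Pi.add_apply, Pi.add_apply, h3, h4]; ring
  smul_mem' := by
    intro c f hf
    have h0 := Lp.coeFn_smul c f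
    change ∀ᵐ θ : Torus, (c • f : LTwo) (-θ) = -(c • f : LTwo) θ
    change ∀ᵐ θ : Torus, f (-θ) = -f θ at hf
    filter_upwards [h0, ae_neg h0, hf] with θ h1 h2 h3
    rw [h1, h2, Pi.smul_apply, Pi.smul_apply, h3, smul_neg]

/-- The Hilbert space `H_o`, with the inner product of `L²(ℝ / 2πℤ, ℂ)`. -/
abbrev Hodd : Type := oddSubspace

theorem memLp_mode (k : ℕ) :
    MemLp (fun θ : Torus => ((sinT k θ / √π : ℝ) : ℂ)) 2 (volume : Measure Torus) := by
  refine MemLp.of_bound (C := 1 / √π) ?_ (ae_of_all _ fun θ => ?_)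
  · exact (Complex.continuous_ofReal.comp
      ((continuous_sinT k).div_const _)).aestronglyMeasurable
  · rw [Complex.norm_real, Real.norm_eq_abs, abs_div, abs_of_nonneg (Real.sqrt_nonneg π)]
    exact div_le_div_of_nonneg_right (abs_sinT_le k θ) (Real.sqrt_nonneg π)

/-- The mode `φ_k : θ ↦ sin (k θ) / √π`, for `k ≥ 1`. -/
def mode (k : ℕ) : Hodd :=
  ⟨(memLp_mode k).toLp _, by
    have h0 := (memLp_mode k).coeFn_toLp
    change ∀ᵐ θ : Torus, _
    filter_upwards [h0, ae_neg h0] with θ h1 h2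
    rw [h1, h2, sinT_neg]
    push_cast
    ring⟩

/-- `L_N`, the linear span of `φ_1, …, φ_N`. -/
def modeSpan (N : ℕ) : Submodule ℂ Hodd := Submodule.span ℂ (mode '' Set.Icc 1 N)

/-! ### The operators of the system -/

theorem integrable_haar (f : LTwo) : Integrable f (AddCircle.haarAddCircle (T := 2 * π)) :=
  ((memLp_haarAddCircle_iff (T := 2 * π)).2 (Lp.memLp f)).integrable (by norm_num)

theorem ae_haar {p : Torus → Prop} (h : ∀ᵐ θ, p θ) :
    ∀ᵐ θ ∂(AddCircle.haarAddCircle (T := 2 * π)), p θ := by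
  refine Measure.AbsolutelyContinuous.ae_le ?_ h
  rw [AddCircle.volume_eq_smul_haarAddCircle]
  exact Measure.absolutelyContinuous_smul (by simp [Real.pi_pos])

/-- The graph of `i |Δ|^α` on `H_o`: the operator `|Δ|^α` multiplies the Fourier coefficient of
index `k` by `|k|^(2α)`, and its domain consists of the `ψ` for which this yields an element of
the space. -/
def driftGraph (α : ℝ) : Submodule ℂ (Hodd × Hodd) where
  carrier := {p | ∀ k : ℤ, fourierCoeff ((p.2 : LTwo) : Torus → ℂ) k
    = Complex.I * (((|(k : ℝ)| ^ (2 * α) : ℝ) : ℂ) * fourierCoeff ((p.1 : LTwo) : Torus → ℂ) k)}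
  zero_mem' := by
    intro k
    have h0 : fourierCoeff (((0 : Hodd) : LTwo) : Torus → ℂ) = 0 := by
      have h1 := fourierCoeff_congr_ae (ae_haar (Lp.coeFn_zero ℂ 2 (volume : Measure Torus)))
      refine h1.trans ?_
      ext k
      simp [fourierCoeff]
    simp only [Prod.fst_zero, Prod.snd_zero, h0, Pi.zero_apply, mul_zero]
  add_mem' := by
    intro p q hp hq k
    have key : ∀ f g : Hodd, fourierCoeff (((f + g : Hodd) : LTwo) : Torus → ℂ) k
        = fourierCoeff ((f : LTwo) : Torus → ℂ) k + fourierCoeff ((g : LTwo) : Torus → ℂ) k := by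
      intro f g
      rw [Submodule.coe_add, fourierCoeff_congr_ae (ae_haar (Lp.coeFn_add (f : LTwo) (g : LTwo))),
        fourierCoeff.add (integrable_haar _) (integrable_haar _), Pi.add_apply]
    rw [Prod.fst_add, Prod.snd_add, key, key, hp k, hq k]
    ring
  smul_mem' := by
    intro c p hp k
    have key : ∀ f : Hodd, fourierCoeff (((c • f : Hodd) : LTwo) : Torus → ℂ) k
        = c * fourierCoeff ((f : LTwo) : Torus → ℂ) k := by
      intro f
      rw [Submodule.coe_smul, fourierCoeff_congr_ae (ae_haar (Lp.coeFn_smul c (f : LTwo))),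
        fourierCoeff.const_smul, smul_eq_mul]
    rw [Prod.smul_fst, Prod.smul_snd, key, key, hp k]
    ring

/-- The drift operator `A = i |Δ|^α` on `H_o`. -/
def drift (α : ℝ) : Hodd →ₗ.[ℂ] Hodd := (driftGraph α).toLinearPMap

theorem eq_zero_of_fourierCoeff (f : Hodd)
    (h : ∀ k, fourierCoeff ((f : LTwo) : Torus → ℂ) k = 0) : f = 0 := by
  have hm : MemLp ((f : LTwo) : Torus → ℂ) 2 (AddCircle.haarAddCircle (T := 2 * π)) :=
    (memLp_haarAddCircle_iff (T := 2 * π)).2 (Lp.memLp (f : LTwo))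
  have h0 : hm.toLp _ = 0 := by
    apply (fourierBasis (T := 2 * π)).repr.injective
    ext k
    rw [fourierBasis_repr, fourierCoeff_congr_ae hm.coeFn_toLp, h k]
    simp
  have h1 := hm.coeFn_toLp
  rw [h0] at h1
  have h2 : ((f : LTwo) : Torus → ℂ) =ᵐ[AddCircle.haarAddCircle (T := 2 * π)] 0 :=
    h1.symm.trans (Lp.coeFn_zero ℂ 2 _)
  apply Subtype.ext
  apply Lp.ext
  refine EventuallyEq.trans ?_ (Lp.coeFn_zero ℂ 2 (volume : Measure Torus)).symm
  refine Measure.AbsolutelyContinuous.ae_le ?_ h2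
  rw [AddCircle.volume_eq_smul_haarAddCircle]
  exact Measure.smul_absolutelyContinuous

/-- The relation `driftGraph α` is the graph of the operator `drift α`. -/
theorem drift_graph (α : ℝ) : (drift α).graph = driftGraph α := by
  apply Submodule.toLinearPMap_graph_eq
  rintro ⟨ψ, η⟩ hp (rfl : ψ = 0)
  refine eq_zero_of_fourierCoeff η fun k => ?_
  have h0 := (driftGraph α).zero_mem k
  have h1 := hp k
  simp only [Prod.fst_zero, Prod.snd_zero] at h0 h1
  rw [h1, ← h0]
  have h2 := fourierCoeff_congr_ae (ae_haar (Lp.coeFn_zero ℂ 2 (volume : Measure Torus)))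
  refine (congrFun h2 k).trans ?_
  simp [fourierCoeff]

theorem memLp_cos_mul (f : LTwo) :
    MemLp (fun θ : Torus => -Complex.I * (cosT θ : ℂ) * f θ) 2 (volume : Measure Torus) := by
  refine (Lp.memLp f).mono ?_ (ae_of_all _ fun θ => ?_)
  · exact ((Continuous.aestronglyMeasurable (by
      exact continuous_const.mul (Complex.continuous_ofReal.comp continuous_cosT))).mul
      (Lp.aestronglyMeasurable f))
  · rw [norm_mul, norm_mul, norm_neg, Complex.norm_I, one_mul, Complex.norm_real,
      Real.norm_eq_abs]
    exact mul_le_of_le_one_left (norm_nonneg _) (abs_cosT_le θ)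

/-- The control operator `B` on `H_o`, multiplication by `-i cos θ`. -/
def coupling : Hodd →ₗ[ℂ] Hodd where
  toFun f := ⟨(memLp_cos_mul f).toLp _, by
    have h0 := (memLp_cos_mul f).coeFn_toLp
    have hf : ∀ᵐ θ : Torus, (f : LTwo) (-θ) = -(f : LTwo) θ := f.2
    change ∀ᵐ θ : Torus, _
    filter_upwards [h0, ae_neg h0, hf] with θ h1 h2 h3
    rw [h1, h2, h3, cosT_neg]
    ring⟩
  map_add' f g := by
    apply Subtype.ext
    apply Lp.ext
    refine (memLp_cos_mul (f + g : Hodd)).coeFn_toLp.trans ?_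
    refine EventuallyEq.trans ?_ (Lp.coeFn_add _ _).symm
    filter_upwards [(memLp_cos_mul f).coeFn_toLp, (memLp_cos_mul g).coeFn_toLp,
      Lp.coeFn_add (f : LTwo) (g : LTwo)] with θ h1 h2 h3
    rw [Pi.add_apply, h1, h2, Submodule.coe_add, h3, Pi.add_apply]
    ring
  map_smul' c f := by
    apply Subtype.ext
    apply Lp.ext
    refine (memLp_cos_mul (c • f : Hodd)).coeFn_toLp.trans ?_
    refine EventuallyEq.trans ?_ (Lp.coeFn_smul _ _).symm
    filter_upwards [(memLp_cos_mul f).coeFn_toLp, Lp.coeFn_smul c (f : LTwo)] with θ h1 h2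
    rw [Pi.smul_apply, RingHom.id_apply, h1, Submodule.coe_smul, h2, Pi.smul_apply,
      smul_eq_mul, smul_eq_mul]
    ring

end TorusControl

end

namespace TorusControl

universe u

/-! In the basis of modes the drift is diagonal with entries `i k^(2α)`, and the coupling only links
neighbouring modes. The gaps `(k+1)^(2α) - k^(2α)` are pairwise distinct: by a convexity estimate
(`rpow_second_difference`), the gap at `k` differs from every other one by at least `δ = α²
k^(2α-2)`. A small control `4θ cos(ωt + φ)` tuned to the gap at `k` therefore acts, on average, as a
rotation of the coordinates `k` and `k+1` alone, all other transitions being off resonance. A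
rotation by an angle at most `π/2` in time `T` costs an error at most `64/(Tδ)`
(`approxSteers_pulse`).

The averaging is explicit. To the ideal rotating trajectory one adds a corrector of size `O(θ/δ)`
absorbing the non-resonant forcing (`exists_corrector`). The corrected curve stays in the domain of
the drift and solves the equation up to `O(θ²/δ)`; a Duhamel estimate
(`IsUnitaryGroupOf.norm_sub_le_of_approx`) compares it with the true flow, and sampling the cosine
finely gives piecewise constant controls at arbitrarily small extra cost (`approxSteers_of_approx`).
The flows exist because each `A + vB` is `i` times a self-adjoint operator with compact resolvent,
hence diagonalizable (`exists_isUnitaryGroupOf_vadd`).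

Pulses on the pairs `(P-1, P), …, (N₀, N₀+1)`, with angle and phase chosen to empty the upper mode
each time, bring `ψ₀` to a multiple of `φ_N₀`. Reversed pulses lead from a multiple of `φ_N₀` to
`ψ₁`, and free evolution for at most one period `2π / N₀^(2α)` joins the two multiples. By unitarity
the errors add up. With pulse durations `κ k^(-(2α-4))` the errors are proportional to `κ⁻¹ k⁻²`, so
both series converge, uniformly in `P`; the durations are summable exactly because `α > 5/2`. Taking
`κ` of order `1/(ε α² (N₀-1))` gives the bound. -/

theorem mem_graph_vadd_iff {H : Type*} [NormedAddCommGroup H] [InnerProductSpace ℂ H]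
    (B : H →ₗ[ℂ] H) (A : H →ₗ.[ℂ] H) (x y : H) :
    (x, y) ∈ (B +ᵥ A).graph ↔ (x, y - B x) ∈ A.graph := by
  simp only [LinearPMap.mem_graph_iff]
  constructor
  · rintro ⟨z, hz, hz'⟩
    refine ⟨z, hz, ?_⟩
    rw [← hz', LinearPMap.vadd_apply, ← hz]
    simp
  · rintro ⟨z, hz, hz'⟩
    refine ⟨z, hz, ?_⟩
    rw [LinearPMap.vadd_apply]
    erw [hz']
    simp [hz]

/-! ### Unitary groups that are diagonal in a Hilbert basis -/

section Diagonal

variable {ι : Type*} {H : Type*} [NormedAddCommGroup H] [InnerProductSpace ℂ H]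

theorem hasSum_sq_norm_inner (b : HilbertBasis ι ℂ H) (x : H) :
    HasSum (fun j => ‖inner ℂ (b j) x‖ ^ 2) (‖x‖ ^ 2) := by
  have h := b.hasSum_inner_mul_inner x x
  rw [inner_self_eq_norm_sq_to_K] at h
  have h2 : ∀ j, inner ℂ x (b j) * inner ℂ (b j) x = ((‖inner ℂ (b j) x‖ ^ 2 : ℝ) : ℂ) := by
    intro j
    rw [← inner_conj_symm, RCLike.conj_mul]
    push_cast
    rfl
  simp_rw [h2] at h
  have h3 : ((‖x‖ : ℂ) ^ 2) = ((‖x‖ ^ 2 : ℝ) : ℂ) := by push_cast; rfl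
  erw [h3] at h
  exact_mod_cast h

theorem ext_inner_hilbertBasis (b : HilbertBasis ι ℂ H) {x y : H}
    (h : ∀ j, inner ℂ (b j) x = inner ℂ (b j) y) : x = y := by
  apply b.repr.injective
  ext j
  simpa only [HilbertBasis.repr_apply_apply] using h j

/-- By Parseval, the squared distance to `y` is a sum over coordinates, to which dominated
convergence applies. -/
theorem tendsto_of_tendsto_inner {β : Type*} {l : Filter β} (b : HilbertBasis ι ℂ H) (f : β → H)
    (y : H) (bound : ι → ℝ) (hs : Summable bound)
    (hb : ∀ᶠ t in l, ∀ j, ‖inner ℂ (b j) (f t - y)‖ ^ 2 ≤ bound j)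
    (hl : ∀ j, Tendsto (fun t => inner ℂ (b j) (f t)) l (𝓝 (inner ℂ (b j) y))) :
    Tendsto f l (𝓝 y) := by
  rw [tendsto_iff_norm_sub_tendsto_zero]
  have h1 : Tendsto (fun t => ∑' j, ‖inner ℂ (b j) (f t - y)‖ ^ 2) l (𝓝 (∑' _ : ι, (0 : ℝ))) := by
    refine tendsto_tsum_of_dominated_convergence hs (fun j => ?_) ?_
    · have := (hl j).sub_const (inner ℂ (b j) y)
      rw [sub_self] at this
      have := (this.norm).pow 2
      simpa [inner_sub_right] using this
    · filter_upwards [hb] with t ht j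
      rw [Real.norm_of_nonneg (by positivity)]
      exact ht j
  simp_rw [(hasSum_sq_norm_inner b _).tsum_eq, tsum_zero] at h1
  have := h1.sqrt
  simpa using this

variable [CompleteSpace H]

/-- The Hilbert basis whose vectors are those of `b`, multiplied by the phases
`exp (i t (μ j))`. -/
noncomputable def phaseBasis (b : HilbertBasis ι ℂ H) (μ : ι → ℝ) (t : ℝ) : HilbertBasis ι ℂ H :=
  HilbertBasis.mkOfOrthogonalEqBot (v := fun j => Complex.exp ((t * μ j : ℝ) * Complex.I) • b j)
    (by
      refine ⟨fun j => ?_, ?_⟩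
      · rw [norm_smul, b.orthonormal.1, Complex.norm_exp_ofReal_mul_I, mul_one]
      · intro i j hij
        simp only
        rw [inner_smul_left, inner_smul_right, b.orthonormal.2 hij, mul_zero, mul_zero])
    (by
      rw [eq_bot_iff]
      intro x hx
      rw [Submodule.mem_bot]
      refine ext_inner_hilbertBasis b fun j => ?_
      have := (Submodule.mem_orthogonal _ _).1 hx _ (Submodule.subset_span ⟨j, rfl⟩)
      simp only at this
      rw [inner_smul_left, mul_eq_zero] at this
      rw [inner_zero_right]
      refine this.resolve_left ?_
      simp [Complex.exp_ne_zero])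

theorem phaseBasis_apply (b : HilbertBasis ι ℂ H) (μ : ι → ℝ) (t : ℝ) (j : ι) :
    phaseBasis b μ t j = Complex.exp ((t * μ j : ℝ) * Complex.I) • b j := by
  exact congrFun (HilbertBasis.coe_mkOfOrthogonalEqBot _ _) j

/-- The unitary operator multiplying the coordinate of index `j` by `exp (i t (μ j))`. -/
noncomputable def diagonalGroup (b : HilbertBasis ι ℂ H) (μ : ι → ℝ) (t : ℝ) : H ≃ₗᵢ[ℂ] H :=
  b.repr.trans (phaseBasis b μ t).repr.symm

theorem inner_diagonalGroup (b : HilbertBasis ι ℂ H) (μ : ι → ℝ) (t : ℝ) (x : H) (j : ι) :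
    inner ℂ (b j) (diagonalGroup b μ t x)
      = Complex.exp ((t * μ j : ℝ) * Complex.I) * inner ℂ (b j) x := by
  have h : (phaseBasis b μ t).repr (diagonalGroup b μ t x) j = b.repr x j := by
    simp [diagonalGroup]
  rw [HilbertBasis.repr_apply_apply, HilbertBasis.repr_apply_apply, phaseBasis_apply,
    inner_smul_left, ← Complex.exp_conj] at h
  rw [← h, ← mul_assoc, ← Complex.exp_add]
  simp only [map_mul, Complex.conj_ofReal, Complex.conj_I]
  ring_nf
  simp

theorem norm_exp_mul_I_sub_one_le (x : ℝ) : ‖Complex.exp (x * Complex.I) - 1‖ ≤ |x| := by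
  have := Real.norm_exp_I_mul_ofReal_sub_one_le (x := x)
  rwa [mul_comm, Real.norm_eq_abs] at this

/-- The hypothesis `hG` says that `G` has the maximal domain. Since `|exp(itμ) - 1| ≤ |tμ|`, the
coordinates of a difference quotient of the orbit of `x` are dominated by those of `y = G x`, so
coordinatewise convergence upgrades to convergence in norm. The converse reads off coordinates of
the derivative. -/
theorem isUnitaryGroupOf_diagonalGroup (b : HilbertBasis ι ℂ H) (μ : ι → ℝ) (G : H →ₗ.[ℂ] H)
    (hG : ∀ x y, (x, y) ∈ G.graph ↔
      ∀ j, inner ℂ (b j) y = Complex.I * (μ j * inner ℂ (b j) x)) :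
    IsUnitaryGroupOf G (diagonalGroup b μ) where
  map_zero x := by
    refine ext_inner_hilbertBasis b fun j => ?_
    rw [inner_diagonalGroup]
    simp
  map_add s t x := by
    refine ext_inner_hilbertBasis b fun j => ?_
    rw [inner_diagonalGroup, inner_diagonalGroup, inner_diagonalGroup, ← mul_assoc,
      ← Complex.exp_add]
    push_cast
    ring_nf
  continuous_orbit x := by
    rw [continuous_iff_continuousAt]
    intro s
    refine tendsto_of_tendsto_inner b _ _ (fun j => 4 * ‖inner ℂ (b j) x‖ ^ 2)
      ((hasSum_sq_norm_inner b x).summable.mul_left 4) (Eventually.of_forall fun t j => ?_)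
      fun j => ?_
    · have h1 : ‖inner ℂ (b j) (diagonalGroup b μ t x - diagonalGroup b μ s x)‖
          ≤ 2 * ‖inner ℂ (b j) x‖ := by
        rw [inner_sub_right, inner_diagonalGroup, inner_diagonalGroup]
        refine (norm_sub_le _ _).trans ?_
        rw [norm_mul, norm_mul, Complex.norm_exp_ofReal_mul_I, Complex.norm_exp_ofReal_mul_I]
        linarith
      nlinarith [norm_nonneg (inner ℂ (b j) (diagonalGroup b μ t x - diagonalGroup b μ s x))]
    · simp_rw [inner_diagonalGroup]
      have : Continuous fun t : ℝ => Complex.exp ((t * μ j : ℝ) * Complex.I) * inner ℂ (b j) x := by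
        fun_prop
      exact this.tendsto s
  generator x y := by
    have hd : ∀ j, HasDerivAt (fun t : ℝ => inner ℂ (b j) (diagonalGroup b μ t x))
        (Complex.I * (μ j * inner ℂ (b j) x)) 0 := by
      intro j
      simp_rw [inner_diagonalGroup]
      have h1 : HasDerivAt (fun t : ℝ => ((t * μ j : ℝ) : ℂ) * Complex.I)
          (((1 * μ j : ℝ) : ℂ) * Complex.I) 0 :=
        (((hasDerivAt_id (0 : ℝ)).mul_const (μ j)).ofReal_comp).mul_const _
      refine (h1.cexp.mul_const _).congr_deriv ?_
      simp
      ring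
    rw [hG]
    constructor
    · intro h
      rw [hasDerivAt_iff_tendsto_slope]
      refine tendsto_of_tendsto_inner b _ _ (fun j => 4 * ‖inner ℂ (b j) y‖ ^ 2)
        ((hasSum_sq_norm_inner b y).summable.mul_left 4) ?_ fun j => ?_
      · filter_upwards [self_mem_nhdsWithin] with t ht j
        have ht : t ≠ 0 := ht
        have h1 : ‖inner ℂ (b j) (slope (fun t => diagonalGroup b μ t x) 0 t - y)‖
            ≤ 2 * ‖inner ℂ (b j) y‖ := by
          have h2 : ‖inner ℂ (b j) (slope (fun t => diagonalGroup b μ t x) 0 t)‖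
              ≤ ‖inner ℂ (b j) y‖ := by
            rw [slope_def_module, sub_zero, ← Complex.coe_smul, inner_smul_right, inner_sub_right,
              inner_diagonalGroup, inner_diagonalGroup, h j]
            have h3 : Complex.exp ((t * μ j : ℝ) * Complex.I) * inner ℂ (b j) x
                - Complex.exp ((0 * μ j : ℝ) * Complex.I) * inner ℂ (b j) x
                = (Complex.exp ((t * μ j : ℝ) * Complex.I) - 1) * inner ℂ (b j) x := by
              simp; ring
            rw [h3, norm_mul, norm_mul, norm_mul, norm_mul, Complex.norm_I, Complex.norm_real,
              Complex.norm_real, one_mul, ← mul_assoc]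
            refine mul_le_mul_of_nonneg_right ?_ (norm_nonneg _)
            rw [norm_inv, inv_mul_le_iff₀ (norm_pos_iff.2 ht)]
            refine (norm_exp_mul_I_sub_one_le _).trans_eq ?_
            rw [abs_mul]; rfl
          rw [inner_sub_right]
          refine (norm_sub_le _ _).trans ?_
          linarith
        nlinarith [norm_nonneg (inner ℂ (b j) (slope (fun t => diagonalGroup b μ t x) 0 t - y))]
      · rw [h j]
        have := hasDerivAt_iff_tendsto_slope.1 (hd j)
        refine this.congr fun t => ?_
        rw [slope_def_module, slope_def_module, ← inner_sub_right, ← Complex.coe_smul,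
          ← Complex.coe_smul, inner_smul_right, smul_eq_mul]
    · intro h j
      refine HasDerivAt.unique ?_ (hd j)
      exact ((innerSL ℂ (b j)).restrictScalars ℝ).hasFDerivAt.comp_hasDerivAt (0 : ℝ) h

end Diagonal

/-- Spectral theorem for compact symmetric operators: Hilbert bases of the eigenspaces are glued
together, and the total family is complete because the eigenspaces have trivial common orthogonal
complement. -/
theorem exists_hilbertBasis_eigenvectors {H : Type u} [NormedAddCommGroup H]
    [InnerProductSpace ℂ H] [CompleteSpace H] (R : H →L[ℂ] H) (hc : IsCompactOperator R)
    (hs : (R : H →ₗ[ℂ] H).IsSymmetric) :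
    ∃ (ι : Type u) (b : HilbertBasis ι ℂ H) (r : ι → ℝ), ∀ j, R (b j) = (r j : ℂ) • b j := by
  have hcomp : ∀ μ : ℂ, CompleteSpace (Module.End.eigenspace (R : H →ₗ[ℂ] H) μ) := by
    intro μ
    have : IsClosed ((Module.End.eigenspace (R : H →ₗ[ℂ] H) μ : Set H)) := by
      have h : (Module.End.eigenspace (R : H →ₗ[ℂ] H) μ : Set H) = {x | R x = μ • x} := by
        ext x
        simp
      rw [h]
      exact isClosed_eq R.continuous (continuous_const_smul μ)
    exact this.completeSpace_coe
  choose w c hw using fun μ : ℂ =>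
    exists_hilbertBasis ℂ (Module.End.eigenspace (R : H →ₗ[ℂ] H) μ)
  have ho := hs.orthogonalFamily_eigenspaces.orthonormal_sigma_orthonormal
    (v_family := fun μ => c μ) (fun μ => (c μ).orthonormal)
  have hbot := ContinuousLinearMap.orthogonalComplement_iSup_eigenspaces_eq_bot hc hs
  let b := HilbertBasis.mkOfOrthogonalEqBot ho (by
    rw [eq_bot_iff, ← hbot]
    intro x hx
    rw [Submodule.mem_orthogonal] at hx
    rw [← Submodule.iInf_orthogonal, Submodule.mem_iInf]
    intro μ
    rw [Submodule.mem_orthogonal]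
    intro y hy
    have h1 := (c μ).hasSum_repr ⟨y, hy⟩
    have h2 := h1.mapL (Module.End.eigenspace (R : H →ₗ[ℂ] H) μ).subtypeL
    have h3 := h2.mapL (innerSL ℂ x)
    have h4 : ∀ i, inner ℂ x ((c μ i : Module.End.eigenspace (R : H →ₗ[ℂ] H) μ) : H) = 0 := by
      intro i
      rw [← inner_conj_symm]
      exact (congrArg _ (hx _ (Submodule.subset_span ⟨⟨μ, i⟩, rfl⟩))).trans (map_zero _)
    simp [h4] at h3
    rw [← inner_conj_symm, h3.unique hasSum_zero, map_zero])
  have hb : ∀ j, R (b j) = j.1 • b j := by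
    rintro ⟨μ, i⟩
    rw [HilbertBasis.coe_mkOfOrthogonalEqBot]
    exact Module.End.mem_eigenspace_iff.1 (c μ i).2
  refine ⟨_, b, fun j => j.1.re, fun j => ?_⟩
  have h1 := hs (b j) (b j)
  have h2 : inner ℂ (b j) (b j) = (1 : ℂ) := by
    rw [inner_self_eq_norm_sq_to_K, b.orthonormal.1]; simp
  change inner ℂ (R (b j)) (b j) = inner ℂ (b j) (R (b j)) at h1
  rw [hb, inner_smul_left, inner_smul_right, h2, mul_one, mul_one] at h1
  rw [hb, Complex.conj_eq_iff_re.1 h1]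


/-! ### Bounded perturbations of a diagonal operator, through a compact resolvent -/

section Perturbation

variable {H : Type u} [NormedAddCommGroup H] [InnerProductSpace ℂ H]

/-- The diagonal operator with coefficients `d` in the Hilbert basis `b`. -/
noncomputable def diagonalSum (b : HilbertBasis ℕ ℂ H) (d : ℕ → ℝ) : H →L[ℂ] H :=
  ∑' n, (d n : ℂ) • InnerProductSpace.rankOne ℂ (b n) (b n)

theorem norm_diagonalSum_term_le (b : HilbertBasis ℕ ℂ H) (d : ℕ → ℝ) (n : ℕ) :
    ‖(d n : ℂ) • InnerProductSpace.rankOne ℂ (b n) (b n)‖ ≤ |d n| := by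
  rw [norm_smul, InnerProductSpace.norm_rankOne, b.orthonormal.1]
  simp

theorem hasSum_diagonalSum [CompleteSpace H] (b : HilbertBasis ℕ ℂ H) {d : ℕ → ℝ}
    (hd : Summable fun n => |d n|) :
    HasSum (fun n => (d n : ℂ) • InnerProductSpace.rankOne ℂ (b n) (b n)) (diagonalSum b d) :=
  (Summable.of_norm_bounded hd (norm_diagonalSum_term_le b d)).hasSum

theorem inner_diagonalSum [CompleteSpace H] (b : HilbertBasis ℕ ℂ H) {d : ℕ → ℝ}
    (hd : Summable fun n => |d n|) (x : H) (n : ℕ) :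
    inner ℂ (b n) (diagonalSum b d x) = d n * inner ℂ (b n) x := by
  have h1 := (hasSum_diagonalSum b hd).mapL (ContinuousLinearMap.apply ℂ H x)
  have h2 := h1.mapL (innerSL ℂ (b n))
  refine h2.unique ?_
  have h3 : ∀ m, (innerSL ℂ (b n)) ((ContinuousLinearMap.apply ℂ H x)
      ((d m : ℂ) • InnerProductSpace.rankOne ℂ (b m) (b m)))
      = if m = n then d n * inner ℂ (b n) x else 0 := by
    intro m
    simp only [ContinuousLinearMap.apply_apply, innerSL_apply_apply, smul_apply,
      InnerProductSpace.rankOne_apply, inner_smul_right,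
      orthonormal_iff_ite.1 b.orthonormal n m]
    rcases eq_or_ne m n with h | h
    · subst h; simp
    · simp [h, h.symm]
  simp_rw [h3]
  exact hasSum_ite_eq n _

theorem norm_diagonalSum_le [CompleteSpace H] (b : HilbertBasis ℕ ℂ H) {d : ℕ → ℝ}
    (hd : Summable fun n => |d n|) :
    ‖diagonalSum b d‖ ≤ ∑' n, |d n| :=
  tsum_of_norm_bounded hd.hasSum (norm_diagonalSum_term_le b d)

/-- Norm limit of finite-rank partial sums. -/
theorem isCompactOperator_diagonalSum [CompleteSpace H] (b : HilbertBasis ℕ ℂ H) {d : ℕ → ℝ}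
    (hd : Summable fun n => |d n|) : IsCompactOperator (diagonalSum b d) := by
  refine isCompactOperator_of_tendsto (hasSum_diagonalSum b hd) (Eventually.of_forall fun s => ?_)
  have : ∀ n, IsCompactOperator ((d n : ℂ) • InnerProductSpace.rankOne ℂ (b n) (b n)) := by
    intro n
    refine IsCompactOperator.smul ?_ _
    rw [InnerProductSpace.rankOne_def']
    exact (isCompactOperator_of_locallyCompactSpace_rng
      (ContinuousLinearMap.toSpanSingleton ℂ (b n))).comp_clm (innerSL ℂ (b n))
  exact Submodule.sum_mem (compactOperator (RingHom.id ℂ) H H) fun n _ => this n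

theorem inner_diagonalSum_comm [CompleteSpace H] (b : HilbertBasis ℕ ℂ H) {d : ℕ → ℝ}
    (hd : Summable fun n => |d n|) (x y : H) :
    inner ℂ (diagonalSum b d x) y = inner ℂ x (diagonalSum b d y) := by
  rw [← b.tsum_inner_mul_inner, ← b.tsum_inner_mul_inner x]
  refine tsum_congr fun n => ?_
  rw [inner_diagonalSum b hd, ← inner_conj_symm, inner_diagonalSum b hd, map_mul,
    Complex.conj_ofReal, inner_conj_symm]
  ring

/-- A bounded skew-adjoint perturbation of a diagonal operator with summable inverse generates a
unitary group. -/
theorem exists_isUnitaryGroupOf_vadd [CompleteSpace H] (b : HilbertBasis ℕ ℂ H) (lam : ℕ → ℝ)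
    (hpos : ∀ n, 0 < lam n) (hsum : Summable fun n => (√(lam n))⁻¹)
    (A : H →ₗ.[ℂ] H) (hA : ∀ x y, (x, y) ∈ A.graph ↔
      ∀ n, inner ℂ (b n) y = Complex.I * (lam n * inner ℂ (b n) x))
    (C : H →L[ℂ] H) (hC : ∀ x y, inner ℂ (C x) y = inner ℂ x (C y))
    (B : H →ₗ[ℂ] H) (hB : ∀ x, B x = -Complex.I • C x) (v : ℝ) :
    ∃ U, IsUnitaryGroupOf (((v : ℂ) • B) +ᵥ A) U := by
  -- Write `Λ` for the diagonal operator with entries `lam n`. The shift `m` is so large that `v D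
  -- C`, with `D = (Λ + m)⁻¹`, is a strict contraction.
  obtain ⟨m, hm0, hm⟩ : ∃ m : ℝ, 0 < m ∧
      |v| * ‖C‖ * ((2 * √m)⁻¹ * ∑' n, (√(lam n))⁻¹) < 1 := by
    have : Tendsto (fun m : ℝ => |v| * ‖C‖ * ((2 * √m)⁻¹ * ∑' n, (√(lam n))⁻¹)) atTop
        (𝓝 (|v| * ‖C‖ * (0 * ∑' n, (√(lam n))⁻¹))) := by
      refine Tendsto.const_mul _ (Tendsto.mul_const _ ?_)
      exact tendsto_inv_atTop_zero.comp
        (Tendsto.const_mul_atTop (by norm_num) Real.tendsto_sqrt_atTop)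
    rw [zero_mul, mul_zero] at this
    obtain ⟨m, h1, h2⟩ := ((this.eventually_lt_const one_pos).and (eventually_gt_atTop 0)).exists
    exact ⟨m, h2, h1⟩
  set d : ℕ → ℝ := fun n => (lam n + m)⁻¹ with hd_def
  have hdpos : ∀ n, 0 < d n := fun n => inv_pos.2 (add_pos (hpos n) hm0)
  -- The inequality `lam n + m ≥ 2 √(lam n) √m` gives both the summability of `d` and a factor
  -- tending to `0` as `m` grows.
  have hdle : ∀ n, |d n| ≤ (2 * √m)⁻¹ * (√(lam n))⁻¹ := by
    intro n
    rw [abs_of_pos (hdpos n), ← mul_inv]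
    have h1 := Real.sqrt_pos.2 hm0
    have h2 := Real.sqrt_pos.2 (hpos n)
    refine inv_anti₀ (by positivity) ?_
    nlinarith [Real.sq_sqrt hm0.le, Real.sq_sqrt (hpos n).le, sq_nonneg (√m - √(lam n))]
  have hds : Summable fun n => |d n| :=
    Summable.of_nonneg_of_le (fun n => abs_nonneg _) hdle (hsum.mul_left _)
  set D := diagonalSum b d with hD
  have hDn : ‖D‖ ≤ (2 * √m)⁻¹ * ∑' n, (√(lam n))⁻¹ := by
    refine (norm_diagonalSum_le b hds).trans ?_
    rw [← tsum_mul_left]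
    exact hds.tsum_le_tsum hdle (hsum.mul_left _)
  have hDinj : ∀ x, D x = 0 → x = 0 := by
    intro x hx
    refine ext_inner_hilbertBasis b fun n => ?_
    have := inner_diagonalSum b hds x n
    rw [← hD, hx, inner_zero_right, zero_eq_mul] at this
    rw [inner_zero_right]
    exact this.resolve_left (by exact_mod_cast (hdpos n).ne')
  have hK : ‖(v : ℂ) • (D * C)‖ < 1 := by
    refine lt_of_le_of_lt ?_ hm
    rw [norm_smul, Complex.norm_real, Real.norm_eq_abs, mul_assoc]
    refine mul_le_mul_of_nonneg_left ?_ (abs_nonneg v)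
    refine (norm_mul_le D C).trans ?_
    rw [mul_comm]
    exact mul_le_mul_of_nonneg_left hDn (norm_nonneg _)
  -- Formally `Λ + m - vC = (Λ + m)(1 - v D C)`, so `R = (1 - v D C)⁻¹ D` is the resolvent of the
  -- perturbed operator.
  set V := Units.oneSub _ hK with hV
  set R : H →L[ℂ] H := (↑V⁻¹ : H →L[ℂ] H) * D with hR
  have hVa : ∀ x, (V : H →L[ℂ] H) x = x - (v : ℂ) • D (C x) := by
    intro x
    simp [hV]
  have hRiff : ∀ x y, R x = y ↔ y - (v : ℂ) • D (C y) = D x := by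
    intro x y
    rw [← hVa]
    constructor
    · rintro rfl
      change ((V : H →L[ℂ] H) * ((↑V⁻¹ : H →L[ℂ] H) * D)) x = _
      rw [← mul_assoc, Units.mul_inv, one_mul]
    · intro h
      change (↑V⁻¹ : H →L[ℂ] H) (D x) = y
      rw [← h]
      change ((↑V⁻¹ : H →L[ℂ] H) * V) y = y
      rw [Units.inv_mul]; rfl
  have hRs : (R : H →ₗ[ℂ] H).IsSymmetric := by
    intro x x'
    change inner ℂ (R x) x' = inner ℂ x (R x')
    obtain ⟨y, hy⟩ : ∃ y, y = R x := ⟨_, rfl⟩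
    obtain ⟨y', hy'⟩ : ∃ y', y' = R x' := ⟨_, rfl⟩
    rw [← hy, ← hy']
    -- The fixed-point form `y = D (x + v C y)` reduces the symmetry of `R` to those of `D` and `C`.
    have h1 : y = D (x + (v : ℂ) • C y) := by
      rw [map_add, ← (hRiff x y).1 hy.symm, map_smul]; abel
    have h2 : y' = D (x' + (v : ℂ) • C y') := by
      rw [map_add, ← (hRiff x' y').1 hy'.symm, map_smul]; abel
    have h3 := inner_diagonalSum_comm b hds (x + (v : ℂ) • C y) (x' + (v : ℂ) • C y')
    rw [← hD, ← h1, ← h2, inner_add_right, inner_add_left, inner_smul_right, inner_smul_left,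
      Complex.conj_ofReal, hC] at h3
    exact add_right_cancel h3
  have hRc : IsCompactOperator R :=
    (isCompactOperator_diagonalSum b hds).clm_comp (↑V⁻¹ : H →L[ℂ] H)
  have hRinj : ∀ x, R x = 0 → x = 0 := by
    intro x hx
    have := (hRiff x 0).1 hx
    simp at this
    exact hDinj x this.symm
  obtain ⟨ι, e, r, he⟩ := exists_hilbertBasis_eigenvectors R hRc hRs
  have hr : ∀ j, r j ≠ 0 := by
    intro j hj
    have h1 := he j
    rw [hj, Complex.ofReal_zero, zero_smul] at h1
    have h2 := e.orthonormal.1 j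
    rw [hRinj _ h1, norm_zero] at h2
    exact zero_ne_one h2
  -- An eigenvalue `r` of `R = (Λ + m - vC)⁻¹` corresponds to the eigenvalue `r⁻¹ - m` of `Λ - vC`.
  refine ⟨diagonalGroup e fun j => (r j)⁻¹ - m, isUnitaryGroupOf_diagonalGroup e _ _ fun x y => ?_⟩
  -- The relation `y = i(Λ - vC)x` means `(Λ + m - vC)x = -iy + mx`, that is, `R (-iy + mx) = x`;
  -- domain questions disappear since `R` is everywhere defined.
  have hgraph : (x, y) ∈ (((v : ℂ) • B) +ᵥ A).graph ↔ R (-Complex.I • y + (m : ℂ) • x) = x := by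
    rw [mem_graph_vadd_iff, hA, hRiff]
    have h1 : (x - (v : ℂ) • D (C x) = D (-Complex.I • y + (m : ℂ) • x)) ↔
        x = D (-Complex.I • y + (m : ℂ) • x + (v : ℂ) • C x) := by
      rw [map_add D _ ((v : ℂ) • C x), map_smul, sub_eq_iff_eq_add]
    rw [h1]
    have h2 : (x = D (-Complex.I • y + (m : ℂ) • x + (v : ℂ) • C x)) ↔
        ∀ n, inner ℂ (b n) x = inner ℂ (b n) (D (-Complex.I • y + (m : ℂ) • x + (v : ℂ) • C x)) :=
      ⟨fun h n => congrArg _ h, fun h => ext_inner_hilbertBasis b h⟩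
    rw [h2]
    refine forall_congr' fun n => ?_
    rw [hD, inner_diagonalSum b hds, LinearMap.smul_apply, hB, inner_sub_right, inner_add_right,
      inner_add_right, inner_smul_right, inner_smul_right, inner_smul_right, inner_smul_right,
      inner_smul_right]
    have h3 : ((lam n + m : ℝ) : ℂ) ≠ 0 := by exact_mod_cast (add_pos (hpos n) hm0).ne'
    simp only [hd_def, Complex.ofReal_inv]
    rw [eq_inv_mul_iff_mul_eq₀ h3]
    push_cast
    constructor
    · intro h
      linear_combination Complex.I * h + (lam n * inner ℂ (b n) x - v * inner ℂ (b n) (C x)) *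
        Complex.I_sq
    · intro h
      linear_combination -Complex.I * h + (inner ℂ (b n) y) * Complex.I_sq
  rw [hgraph]
  have h2 : (R (-Complex.I • y + (m : ℂ) • x) = x) ↔
      ∀ j, inner ℂ (e j) (R (-Complex.I • y + (m : ℂ) • x)) = inner ℂ (e j) x :=
    ⟨fun h n => congrArg _ h, fun h => ext_inner_hilbertBasis e h⟩
  rw [h2]
  refine forall_congr' fun j => ?_
  have h3 : inner ℂ (e j) (R (-Complex.I • y + (m : ℂ) • x))
      = inner ℂ (R (e j)) (-Complex.I • y + (m : ℂ) • x) := (hRs _ _).symm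
  rw [h3, he, inner_smul_left, inner_add_right, inner_smul_right, inner_smul_right,
    Complex.conj_ofReal]
  have h4 : (r j : ℂ) ≠ 0 := by exact_mod_cast hr j
  push_cast
  rw [← eq_inv_mul_iff_mul_eq₀ h4]
  constructor
  · intro h
    linear_combination Complex.I * h + (inner ℂ (e j) y) * Complex.I_sq
  · intro h
    linear_combination -Complex.I * h - ((r j : ℂ)⁻¹ - m) * inner ℂ (e j) x * Complex.I_sq

end Perturbation

/-! ### The Hilbert basis of odd modes -/

/-- Oddness is the closed condition that the isometry induced by `θ ↦ -θ` sends `f` to `-f`. -/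
theorem isClosed_oddSubspace : IsClosed (oddSubspace : Set LTwo) := by
  have hmp := Measure.measurePreserving_neg (volume : Measure Torus)
  have h : (oddSubspace : Set LTwo)
      = {f : LTwo | Lp.compMeasurePreserving (fun θ : Torus => -θ) hmp f = -f} := by
    ext f
    change (∀ᵐ θ : Torus, f (-θ) = -f θ) ↔ _
    rw [Set.mem_ofPred_eq, Lp.ext_iff]
    have h1 := Lp.coeFn_compMeasurePreserving f hmp
    have h2 := Lp.coeFn_neg f
    constructor
    · intro hf
      filter_upwards [hf, h1, h2] with θ h3 h4 h5
      rw [h4, h5]; exact h3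
    · intro hf
      filter_upwards [hf, h1, h2] with θ h3 h4 h5
      rw [h4, h5] at h3; exact h3
  rw [h]
  exact isClosed_eq (Lp.isometry_compMeasurePreserving hmp).continuous continuous_neg

instance completeSpace_Hodd : CompleteSpace Hodd := isClosed_oddSubspace.completeSpace_coe

theorem fourier_apply_neg (n : ℤ) (θ : Torus) : (fourier n (-θ) : ℂ) = fourier (-n) θ := by
  simp only [fourier_apply, smul_neg, neg_smul]

theorem fourierCoeff_neg_of_odd (f : Hodd) (n : ℤ) :
    fourierCoeff ((f : LTwo) : Torus → ℂ) (-n) = -fourierCoeff ((f : LTwo) : Torus → ℂ) n := by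
  have hf : ∀ᵐ θ : Torus, (f : LTwo) (-θ) = -(f : LTwo) θ := f.2
  unfold fourierCoeff
  rw [← integral_neg_eq_self, ← integral_neg]
  refine integral_congr_ae ?_
  filter_upwards [ae_haar hf] with θ hθ
  rw [hθ, fourier_apply_neg, neg_neg, smul_neg]

theorem sinT_eq (k : ℕ) (θ : Torus) :
    (sinT k θ : ℂ) = (fourier (k : ℤ) θ - fourier (-(k : ℤ)) θ) / (2 * Complex.I) := by
  rw [sinT, fourier_neg]
  rw [Complex.sub_conj]
  field_simp
  push_cast
  ring

theorem integral_volume_eq (g : Torus → ℂ) :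
    ∫ θ : Torus, g θ = (2 * π) * ∫ θ, g θ ∂(AddCircle.haarAddCircle (T := 2 * π)) := by
  rw [AddCircle.volume_eq_smul_haarAddCircle, integral_smul_measure,
    ENNReal.toReal_ofReal Real.two_pi_pos.le, Complex.real_smul]
  push_cast
  rfl

theorem inner_mode (k : ℕ) (f : Hodd) :
    inner ℂ (mode k) f = 2 * Complex.I * √π * fourierCoeff ((f : LTwo) : Torus → ℂ) k := by
  have hint : ∀ n : ℤ, Integrable (fun θ : Torus => (fourier n θ : ℂ) * (f : LTwo) θ)
      (AddCircle.haarAddCircle (T := 2 * π)) := by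
    intro n
    refine (integrable_haar (f : LTwo)).bdd_mul (c := 1) ?_ ?_
    · exact (map_continuous (fourier n)).aestronglyMeasurable
    · exact ae_of_all _ fun θ => by rw [fourier_apply, Circle.norm_coe]
  have hc : ∀ n : ℤ, fourierCoeff ((f : LTwo) : Torus → ℂ) n
      = ∫ θ, (fourier (-n) θ : ℂ) * (f : LTwo) θ ∂(AddCircle.haarAddCircle (T := 2 * π)) :=
    fun n => rfl
  have h1 : inner ℂ (mode k) f
      = ∫ θ : Torus, ((fourier (k : ℤ) θ : ℂ) * (f : LTwo) θ - (fourier (-(k : ℤ)) θ : ℂ) * (f : LTwo) θ)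
        * (1 / (2 * Complex.I * √π)) := by
    rw [Submodule.coe_inner, L2.inner_def]
    refine integral_congr_ae ?_
    filter_upwards [(memLp_mode k).coeFn_toLp] with θ hθ
    have : ((mode k : Hodd) : LTwo) θ = ((sinT k θ / √π : ℝ) : ℂ) := hθ
    rw [this, RCLike.inner_apply, Complex.conj_ofReal, Complex.ofReal_div, sinT_eq]
    ring
  rw [h1, integral_volume_eq, integral_mul_const, integral_sub (hint _) (hint _), ← hc k]
  have h2 := hc (-(k : ℤ))
  rw [neg_neg] at h2
  rw [← h2, fourierCoeff_neg_of_odd]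
  have h3 : (√π : ℂ) ≠ 0 := by exact_mod_cast (Real.sqrt_pos.2 Real.pi_pos).ne'
  have h4 : (π : ℂ) = (√π : ℂ) ^ 2 := by exact_mod_cast (Real.sq_sqrt Real.pi_pos.le).symm
  field_simp
  rw [h4]
  linear_combination (-2 * (√π : ℂ) ^ 2 * fourierCoeff ((f : LTwo) : Torus → ℂ) k) * Complex.I_sq

theorem fourierCoeff_mode (k : ℕ) (n : ℤ) :
    fourierCoeff (((mode k : Hodd) : LTwo) : Torus → ℂ) n
      = (1 / (2 * Complex.I * √π)) *
        ((if n = k then 1 else 0) - (if n = -(k : ℤ) then 1 else 0)) := by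
  have h1 : (((mode k : Hodd) : LTwo) : Torus → ℂ) =ᵐ[AddCircle.haarAddCircle (T := 2 * π)]
      (1 / (2 * Complex.I * √π)) • ((fourier (k : ℤ) : Torus → ℂ)
        + (-1 : ℂ) • (fourier (-(k : ℤ)) : Torus → ℂ)) := by
    filter_upwards [ae_haar (memLp_mode k).coeFn_toLp] with θ hθ
    have : ((mode k : Hodd) : LTwo) θ = ((sinT k θ / √π : ℝ) : ℂ) := hθ
    rw [this, Complex.ofReal_div, sinT_eq]
    simp only [Pi.smul_apply, Pi.add_apply, smul_eq_mul]
    ring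
  have hint : ∀ m : ℤ, Integrable (fourier m : Torus → ℂ)
      (AddCircle.haarAddCircle (T := 2 * π)) := fun m =>
    (map_continuous (fourier m)).integrable_of_hasCompactSupport
      (HasCompactSupport.of_compactSpace _)
  rw [fourierCoeff_congr_ae h1, fourierCoeff.const_smul,
    fourierCoeff.add (hint _) ((hint _).smul _), Pi.add_apply, fourierCoeff.const_smul,
    fourierCoeff_fourier, fourierCoeff_fourier, smul_eq_mul, smul_eq_mul, Pi.single_apply,
    Pi.single_apply]
  ring

/-- This lets `coupling_mode` hold at `k = 1` without a boundary case. -/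
theorem mode_zero : mode 0 = 0 := by
  refine eq_zero_of_fourierCoeff _ fun n => ?_
  rw [fourierCoeff_mode]
  simp

theorem orthonormal_mode_succ : Orthonormal ℂ fun n : ℕ => mode (n + 1) := by
  rw [orthonormal_iff_ite]
  intro i j
  rw [inner_mode, fourierCoeff_mode]
  have h3 : (√π : ℂ) ≠ 0 := by exact_mod_cast (Real.sqrt_pos.2 Real.pi_pos).ne'
  have h4 : ¬ (((i + 1 : ℕ) : ℤ) = -((j + 1 : ℕ) : ℤ)) := by omega
  have h5 : (((i + 1 : ℕ) : ℤ) = ((j + 1 : ℕ) : ℤ)) ↔ i = j := by omega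
  rw [if_neg h4]
  simp only [h5]
  have := Complex.I_ne_zero
  split_ifs <;> field_simp <;> simp

/-- The Hilbert basis `φ_1, φ_2, …` of `H_o`. -/
noncomputable def modeBasis : HilbertBasis ℕ ℂ Hodd :=
  HilbertBasis.mkOfOrthogonalEqBot orthonormal_mode_succ (by
    rw [eq_bot_iff]
    intro f hf
    rw [Submodule.mem_bot]
    have h3 : (√π : ℂ) ≠ 0 := by exact_mod_cast (Real.sqrt_pos.2 Real.pi_pos).ne'
    have key : ∀ k : ℕ, fourierCoeff ((f : LTwo) : Torus → ℂ) k = 0 := by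
      intro k
      have h1 : inner ℂ (mode k) f = 0 := by
        rcases k with _ | k
        · rw [mode_zero, inner_zero_left]
        · exact (Submodule.mem_orthogonal _ _).1 hf _ (Submodule.subset_span ⟨k, rfl⟩)
      rw [inner_mode] at h1
      simpa [h3] using h1
    refine eq_zero_of_fourierCoeff f fun n => ?_
    obtain ⟨k, rfl | rfl⟩ := n.eq_nat_or_neg
    · exact key k
    · rw [fourierCoeff_neg_of_odd, key, neg_zero])

theorem modeBasis_apply (n : ℕ) : modeBasis n = mode (n + 1) :=
  congrFun (HilbertBasis.coe_mkOfOrthogonalEqBot _ _) n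

theorem mem_graph_drift_iff (α : ℝ) (x y : Hodd) :
    (x, y) ∈ (drift α).graph ↔ ∀ n, inner ℂ (modeBasis n) y
      = Complex.I * ((((n + 1 : ℕ) : ℝ) ^ (2 * α) : ℝ) * inner ℂ (modeBasis n) x) := by
  have h3 : (√π : ℂ) ≠ 0 := by exact_mod_cast (Real.sqrt_pos.2 Real.pi_pos).ne'
  have hk : ∀ k : ℕ, (fourierCoeff ((y : LTwo) : Torus → ℂ) k
      = Complex.I * ((((k : ℝ) ^ (2 * α) : ℝ) : ℂ) * fourierCoeff ((x : LTwo) : Torus → ℂ) k)) ↔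
      inner ℂ (mode k) y = Complex.I * (((k : ℝ) ^ (2 * α) : ℝ) * inner ℂ (mode k) x) := by
    intro k
    rw [inner_mode, inner_mode]
    have hne : 2 * Complex.I * (√π : ℂ) ≠ 0 := by simp [h3]
    constructor
    · intro h; rw [h]; ring
    · intro h
      refine mul_left_cancel₀ hne ?_
      rw [h]; ring
  rw [drift_graph]
  change (∀ k : ℤ, fourierCoeff ((y : LTwo) : Torus → ℂ) k
    = Complex.I * (((|(k : ℝ)| ^ (2 * α) : ℝ) : ℂ) * fourierCoeff ((x : LTwo) : Torus → ℂ) k)) ↔ _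
  constructor
  · intro h n
    rw [modeBasis_apply, ← hk (n + 1), h]
    simp [abs_of_nonneg (by positivity : (0 : ℝ) ≤ (n : ℝ) + 1)]
  · intro h
    have hnat : ∀ k : ℕ, fourierCoeff ((y : LTwo) : Torus → ℂ) k
        = Complex.I * ((((k : ℝ) ^ (2 * α) : ℝ) : ℂ) *
          fourierCoeff ((x : LTwo) : Torus → ℂ) k) := by
      intro k
      rw [hk]
      rcases k with _ | k
      · rw [mode_zero]; simp
      · rw [← modeBasis_apply]; exact h k
    intro n
    obtain ⟨k, rfl | rfl⟩ := n.eq_nat_or_neg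
    · rw [hnat k]; simp
    · rw [fourierCoeff_neg_of_odd, fourierCoeff_neg_of_odd, hnat k]; simp

/-! ### The coupling in the basis of modes, and the groups it generates with the drift -/

theorem coupling_mode {k : ℕ} (hk : 1 ≤ k) :
    coupling (mode k) = (-(Complex.I / 2)) • (mode (k + 1) + mode (k - 1)) := by
  obtain ⟨j, rfl⟩ : ∃ j, k = j + 1 := ⟨k - 1, by omega⟩
  rw [Nat.add_sub_cancel]
  apply Subtype.ext
  apply Lp.ext
  refine (memLp_cos_mul (mode (j + 1) : Hodd)).coeFn_toLp.trans ?_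
  rw [Submodule.coe_smul, Submodule.coe_add]
  refine EventuallyEq.trans ?_ (Lp.coeFn_smul _ _).symm
  filter_upwards [(memLp_mode (j + 1)).coeFn_toLp, (memLp_mode (j + 1 + 1)).coeFn_toLp,
    (memLp_mode j).coeFn_toLp,
    Lp.coeFn_add ((mode (j + 1 + 1) : Hodd) : LTwo) ((mode j : Hodd) : LTwo)] with θ h1 h2 h3 h4
  change ((mode (j + 1) : Hodd) : LTwo) θ = _ at h1
  change ((mode (j + 1 + 1) : Hodd) : LTwo) θ = _ at h2
  change ((mode j : Hodd) : LTwo) θ = _ at h3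
  rw [Pi.smul_apply, h4, Pi.add_apply, h1, h2, h3]
  have key : cosT θ * sinT (j + 1) θ * 2 = sinT (j + 1 + 1) θ + sinT j θ := by
    induction θ using QuotientAddGroup.induction_on with
    | H x =>
      rw [cosT_coe, sinT_coe, sinT_coe, sinT_coe]
      have e1 : ((j + 1 + 1 : ℕ) : ℝ) * x = ((j + 1 : ℕ) : ℝ) * x + x := by push_cast; ring
      have e2 : (j : ℝ) * x = ((j + 1 : ℕ) : ℝ) * x - x := by push_cast; ring
      rw [e1, e2, Real.sin_add, Real.sin_sub]
      ring
  have key' : (cosT θ : ℂ) * sinT (j + 1) θ * 2 = sinT (j + 1 + 1) θ + sinT j θ := by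
    exact_mod_cast key
  push_cast
  rw [smul_eq_mul]
  linear_combination (-Complex.I / 2 / √π) * key'

theorem norm_coupling_le (f : Hodd) : ‖coupling f‖ ≤ ‖f‖ := by
  rw [Submodule.coe_norm, Submodule.coe_norm]
  refine Lp.norm_le_norm_of_ae_le ?_
  filter_upwards [(memLp_cos_mul f).coeFn_toLp] with θ hθ
  change ((coupling f : Hodd) : LTwo) θ = _ at hθ
  rw [hθ, norm_mul, norm_mul, norm_neg, Complex.norm_I, one_mul, Complex.norm_real,
    Real.norm_eq_abs]
  exact mul_le_of_le_one_left (norm_nonneg _) (abs_cosT_le θ)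

theorem inner_coupling (f g : Hodd) : inner ℂ (coupling f) g = -inner ℂ f (coupling g) := by
  rw [Submodule.coe_inner, Submodule.coe_inner, L2.inner_def, L2.inner_def, ← integral_neg]
  refine integral_congr_ae ?_
  filter_upwards [(memLp_cos_mul f).coeFn_toLp, (memLp_cos_mul g).coeFn_toLp] with θ h1 h2
  change ((coupling f : Hodd) : LTwo) θ = _ at h1
  change ((coupling g : Hodd) : LTwo) θ = _ at h2
  rw [h1, h2, RCLike.inner_apply, RCLike.inner_apply]
  simp only [map_mul, map_neg, Complex.conj_I, Complex.conj_ofReal]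
  ring

/-- The inverse square roots of the eigenvalues are `n^(-α)`, summable for `α > 1`; the bounded
symmetric operator is `C = i B`, multiplication by `cos θ`. -/
theorem exists_isUnitaryGroupOf_drift_coupling {α : ℝ} (hα : 1 < α) (v : ℝ) :
    ∃ U, IsUnitaryGroupOf (((v : ℂ) • coupling) +ᵥ drift α) U := by
  let C : Hodd →L[ℂ] Hodd := LinearMap.mkContinuous (Complex.I • coupling) 1 fun f => by
    rw [LinearMap.smul_apply, norm_smul, Complex.norm_I, one_mul, one_mul]
    exact norm_coupling_le f
  have hC : ∀ f, C f = Complex.I • coupling f := fun f => rfl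
  refine exists_isUnitaryGroupOf_vadd modeBasis (fun n => ((n + 1 : ℕ) : ℝ) ^ (2 * α))
    (fun n => by positivity) ?_ (drift α) (mem_graph_drift_iff α) C ?_ coupling ?_ v
  · have h : ∀ n : ℕ, (√(((n + 1 : ℕ) : ℝ) ^ (2 * α)))⁻¹ = (((n + 1 : ℕ) : ℝ) ^ α)⁻¹ := by
      intro n
      rw [Real.sqrt_eq_rpow, ← Real.rpow_mul (by positivity)]
      ring_nf
    simp_rw [h]
    exact (summable_nat_add_iff 1).2 (Real.summable_nat_rpow_inv.2 hα)
  · intro x y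
    have h1 : inner ℂ (C x) y = -Complex.I * inner ℂ (coupling x) y := by
      rw [← Complex.conj_I]
      exact inner_smul_left (𝕜 := ℂ) (coupling x) y Complex.I
    have h2 : inner ℂ x (C y) = Complex.I * inner ℂ x (coupling y) :=
      inner_smul_right (𝕜 := ℂ) x (coupling y) Complex.I
    rw [h1, h2, inner_coupling]
    ring
  · intro x
    rw [hC, smul_smul]
    simp

/-! ### From approximate trajectories to piecewise constant controls -/

section Steering

variable {H : Type*} [NormedAddCommGroup H] [InnerProductSpace ℂ H]

theorem IsUnitaryGroupOf.apply_neg_apply {G : H →ₗ.[ℂ] H} {U : ℝ → (H ≃ₗᵢ[ℂ] H)}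
    (hU : IsUnitaryGroupOf G U) (t : ℝ) (x : H) : U t (U (-t) x) = x := by
  rw [← hU.map_add, add_neg_cancel, hU.map_zero]

theorem IsUnitaryGroupOf.hasDerivAt_neg {G : H →ₗ.[ℂ] H} {U : ℝ → (H ≃ₗᵢ[ℂ] H)}
    (hU : IsUnitaryGroupOf G U) {x g : H} (hx : (x, g) ∈ G.graph) (s : ℝ) :
    HasDerivAt (fun r => U (-r) x) (-(U (-s) g)) s := by
  have h1 := (hU.generator x g).1 hx
  have h2 : HasDerivAt (fun r => U (s - r) x) (-g) s := by
    have h3 : HasDerivAt (fun r => s - r) (-1) s := (hasDerivAt_id s).const_sub s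
    have h4 : HasDerivAt (fun t => U t x) g (s - s) := by rwa [sub_self]
    exact (HasDerivAt.scomp s h4 h3).congr_deriv (by rw [neg_one_smul])
  have h5 := ((U (-s)).toContinuousLinearEquiv.toContinuousLinearMap.restrictScalars
    ℝ).hasFDerivAt.comp_hasDerivAt s h2
  have h6 : (fun r => U (-r) x) = fun r => U (-s) (U (s - r) x) := by
    funext r
    rw [← hU.map_add]
    ring_nf
  rw [h6]
  exact h5.congr_deriv (map_neg (U (-s)) g)

/-- Only `q s` needs to lie in the domain: split `q r = q s + (q r - q s)`. The first term moves
along a differentiable orbit; for the second, isometry and strong continuity of `U` suffice. -/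
theorem IsUnitaryGroupOf.hasDerivAt_neg_comp {G : H →ₗ.[ℂ] H} {U : ℝ → (H ≃ₗᵢ[ℂ] H)}
    (hU : IsUnitaryGroupOf G U) {q : ℝ → H} {q' g : H} {s : ℝ} (hq : HasDerivAt q q' s)
    (hg : (q s, g) ∈ G.graph) :
    HasDerivAt (fun r => U (-r) (q r)) (U (-s) (q' - g)) s := by
  have h1 := hU.hasDerivAt_neg hg s
  have h2 : HasDerivAt (fun r => U (-r) (q r - q s)) (U (-s) q') s := by
    rw [hasDerivAt_iff_tendsto_slope] at hq ⊢
    have h3 : ∀ r, slope (fun r => U (-r) (q r - q s)) s r = U (-r) (slope q s r) := by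
      intro r
      rw [slope_def_module, slope_def_module, sub_self, _root_.map_zero, sub_zero, ← Complex.coe_smul,
        ← Complex.coe_smul, map_smul]
    rw [funext h3]
    rw [tendsto_iff_norm_sub_tendsto_zero] at hq ⊢
    have h4 : Tendsto (fun r => ‖U (-r) q' - U (-s) q'‖) (𝓝[≠] s) (𝓝 0) := by
      rw [← tendsto_iff_norm_sub_tendsto_zero]
      exact (((hU.continuous_orbit q').comp continuous_neg).tendsto s).mono_left nhdsWithin_le_nhds
    refine squeeze_zero (fun r => norm_nonneg _) (fun r => ?_) (by simpa using hq.add h4)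
    have h5 : U (-r) (slope q s r) - U (-s) q'
        = U (-r) (slope q s r - q') + (U (-r) q' - U (-s) q') := by rw [map_sub]; abel
    rw [h5]
    refine (norm_add_le _ _).trans ?_
    rw [LinearIsometryEquiv.norm_map]
  have h3 := h1.add h2
  have h4 : (fun r => U (-r) (q r)) = (fun r => U (-r) (q s)) + fun r => U (-r) (q r - q s) := by
    funext r
    simp
  rw [h4]
  refine h3.congr_deriv ?_
  rw [map_sub]; abel

/-- A curve which satisfies `q' = G q` up to an error `η` stays close to the orbit of `exp (t G)`. -/
theorem IsUnitaryGroupOf.norm_sub_le_of_approx {G : H →ₗ.[ℂ] H} {U : ℝ → (H ≃ₗᵢ[ℂ] H)}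
    (hU : IsUnitaryGroupOf G U) {q q' g : ℝ → H} {t₀ t₁ η : ℝ} (ht : t₀ ≤ t₁)
    (hq : ∀ s ∈ Set.Icc t₀ t₁, HasDerivAt q (q' s) s)
    (hg : ∀ s ∈ Set.Icc t₀ t₁, (q s, g s) ∈ G.graph)
    (hη : ∀ s ∈ Set.Icc t₀ t₁, ‖q' s - g s‖ ≤ η) :
    ‖U (t₁ - t₀) (q t₀) - q t₁‖ ≤ η * (t₁ - t₀) := by
  -- Duhamel: `U (-r) (q r)` would be constant for an exact solution, and here its derivative has
  -- norm at most `η`.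
  have h1 := norm_image_sub_le_of_norm_deriv_le_segment' (f := fun r => U (-r) (q r))
    (f' := fun s => U (-s) (q' s - g s)) (C := η)
    (fun s hs => (hU.hasDerivAt_neg_comp (hq s hs) (hg s hs)).hasDerivWithinAt)
    (fun s hs => by
      rw [LinearIsometryEquiv.norm_map]
      exact hη s ⟨hs.1, hs.2.le⟩) t₁ ⟨ht, le_rfl⟩
  refine le_trans (le_of_eq ?_) h1
  rw [norm_sub_rev, ← (U t₁).norm_map (U (-t₁) (q t₁) - _), map_sub, hU.apply_neg_apply,
    ← hU.map_add, sub_eq_add_neg t₁ t₀]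

variable {A : H →ₗ.[ℂ] H} {B : H →ₗ[ℂ] H}

/-- Replaying the same unitary groups from another starting point preserves distances. This is why
errors simply add in `ApproxSteers.trans`. -/
theorem Steers.exists_norm_sub_eq {u : List (ℝ × ℝ)} {ψ χ : H} (h : Steers A B u ψ χ) (ψ' : H) :
    ∃ χ', Steers A B u ψ' χ' ∧ ‖χ' - χ‖ = ‖ψ' - ψ‖ := by
  induction h generalizing ψ' with
  | nil ψ => exact ⟨ψ', Steers.nil ψ', rfl⟩
  | cons τ v u ψ χ U hτ hU h ih =>
    obtain ⟨χ', h1, h2⟩ := ih (U τ ψ')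
    refine ⟨χ', Steers.cons τ v u ψ' χ' U hτ hU h1, ?_⟩
    rw [h2, ← map_sub, LinearIsometryEquiv.norm_map]

theorem Steers.append {u w : List (ℝ × ℝ)} {ψ χ ξ : H} (h : Steers A B u ψ χ)
    (h' : Steers A B w χ ξ) : Steers A B (u ++ w) ψ ξ := by
  induction h with
  | nil ψ => exact h'
  | cons τ v u ψ χ U hτ hU _ ih => exact Steers.cons τ v _ ψ ξ U hτ hU (ih h')

theorem duration_append (u w : List (ℝ × ℝ)) :
    duration (u ++ w) = duration u + duration w := by
  simp [duration]

variable (A B) in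
/-- Piecewise constant controls of duration `T` steer `ψ` to within `E + η` of `ψ'`, for every
`η > 0`. -/
def ApproxSteers (T E : ℝ) (ψ ψ' : H) : Prop :=
  ∀ η : ℝ, 0 < η → ∃ u χ, duration u = T ∧ Steers A B u ψ χ ∧ ‖χ - ψ'‖ ≤ E + η

theorem ApproxSteers.refl (ψ : H) : ApproxSteers A B 0 0 ψ ψ := fun η hη =>
  ⟨[], ψ, rfl, Steers.nil ψ, by simpa using hη.le⟩

theorem ApproxSteers.mono {T E E' : ℝ} {ψ ψ' : H} (h : ApproxSteers A B T E ψ ψ') (hE : E ≤ E') :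
    ApproxSteers A B T E' ψ ψ' := by
  intro η hη
  obtain ⟨u, χ, h1, h2, h3⟩ := h η hη
  exact ⟨u, χ, h1, h2, by linarith⟩

theorem ApproxSteers.trans {T T' E E' : ℝ} {ψ ψ' ψ'' : H} (h : ApproxSteers A B T E ψ ψ')
    (h' : ApproxSteers A B T' E' ψ' ψ'') : ApproxSteers A B (T + T') (E + E') ψ ψ'' := by
  intro η hη
  obtain ⟨u, χ, h1, h2, h3⟩ := h (η / 2) (by linarith)
  obtain ⟨w, ξ, k1, k2, k3⟩ := h' (η / 2) (by linarith)
  obtain ⟨ξ', m1, m2⟩ := k2.exists_norm_sub_eq χ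
  refine ⟨u ++ w, ξ', by rw [duration_append, h1, k1], h2.append m1, ?_⟩
  have : ξ' - ψ'' = (ξ' - ξ) + (ξ - ψ'') := by abel
  rw [this]
  refine (norm_add_le _ _).trans ?_
  linarith

/-- An approximate solution of the system for a Lipschitz control is followed by piecewise constant
controls. -/
theorem approxSteers_of_approx
    (hgen : ∀ v : ℝ, ∃ U, IsUnitaryGroupOf (((v : ℂ) • B) +ᵥ A) U) (hB : ∀ x, ‖B x‖ ≤ ‖x‖)
    {T η K M : ℝ} (hT : 0 < T) {q q' a : ℝ → H} {u : ℝ → ℝ}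
    (hK : ∀ s t, |u s - u t| ≤ K * |s - t|) (hM : ∀ s, ‖q s‖ ≤ M)
    (hq : ∀ s, HasDerivAt q (q' s) s) (ha : ∀ s, (q s, a s) ∈ A.graph)
    (hη : ∀ s, ‖q' s - (a s + (u s : ℂ) • B (q s))‖ ≤ η) :
    ApproxSteers A B T (η * T) (q 0) (q T) := by
  have hK0 : 0 ≤ K := by
    have := (abs_nonneg _).trans (hK 0 1)
    simpa using this
  have hM0 : 0 ≤ M := (norm_nonneg _).trans (hM 0)
  -- The control is frozen at its value at the left end of each interval of length `h`; the
  -- Lipschitz bound makes the extra defect at most `K h M`.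
  have step : ∀ h : ℝ, 0 < h → ∀ n : ℕ, ∃ w χ, duration w = n * h ∧ Steers A B w (q 0) χ ∧
      ‖χ - q (n * h)‖ ≤ (η + K * h * M) * (n * h) := by
    intro h hh n
    induction n with
    | zero => exact ⟨[], q 0, by simp [duration], Steers.nil _, by simp⟩
    | succ n ih =>
      obtain ⟨w, χ, h1, h2, h3⟩ := ih
      obtain ⟨U, hU⟩ := hgen (u (n * h))
      have e1 : ((n + 1 : ℕ) : ℝ) * h = n * h + h := by push_cast; ring
      have h4 := hU.norm_sub_le_of_approx (q := q) (q' := q')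
        (g := fun s => a s + ((u (n * h) : ℝ) : ℂ) • B (q s)) (t₀ := n * h) (t₁ := n * h + h)
        (η := η + K * h * M) (by linarith) (fun s _ => hq s)
        (fun s _ => by
          rw [mem_graph_vadd_iff, LinearMap.smul_apply, add_sub_cancel_right]
          exact ha s)
        (fun s hs => by
          have e2 : q' s - (a s + ((u (n * h) : ℝ) : ℂ) • B (q s))
              = (q' s - (a s + (u s : ℂ) • B (q s))) + ((u s - u (n * h) : ℝ) : ℂ) • B (q s) := by
            push_cast
            rw [sub_smul]; abel
          rw [e2]
          refine (norm_add_le _ _).trans (add_le_add (hη s) ?_)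
          rw [norm_smul, Complex.norm_real]
          refine mul_le_mul ((hK _ _).trans ?_) ((hB _).trans (hM s)) (norm_nonneg _)
            (by positivity)
          refine mul_le_mul_of_nonneg_left ?_ hK0
          rw [abs_of_nonneg (by linarith [hs.1])]
          linarith [hs.2])
      rw [add_sub_cancel_left] at h4
      refine ⟨w ++ [(h, u (n * h))], U h χ, ?_, h2.append
        (Steers.cons h _ [] χ _ U hh hU (Steers.nil _)), ?_⟩
      · rw [duration_append, h1, e1]
        simp [duration]
      · rw [e1]
        have e3 : U h χ - q (n * h + h) = U h (χ - q (n * h)) + (U h (q (n * h)) - q (n * h + h)) := by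
          rw [map_sub]; abel
        rw [e3]
        refine (norm_add_le _ _).trans ?_
        rw [LinearIsometryEquiv.norm_map]
        linarith
  intro ε hε
  obtain ⟨N, hN⟩ := exists_nat_gt (K * T * M * T / ε)
  have hN0 : (0 : ℝ) < N + 1 := by positivity
  obtain ⟨w, χ, h1, h2, h3⟩ := step (T / (N + 1)) (by positivity) (N + 1)
  have e1 : ((N + 1 : ℕ) : ℝ) * (T / (N + 1)) = T := by push_cast; field_simp
  rw [e1] at h1 h3
  refine ⟨w, χ, h1, h2, h3.trans ?_⟩
  rw [add_mul]
  have h4 : K * (T / (N + 1)) * M * T ≤ ε := by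
    have : K * (T / (N + 1)) * M * T = K * T * M * T / (N + 1) := by ring
    rw [this, div_le_iff₀ hN0]
    rw [div_lt_iff₀ hε] at hN
    nlinarith
  linarith

end Steering

/-! ### Correctors and rotations of two neighbouring coordinates -/

section Pulse

variable {H : Type*} [NormedAddCommGroup H] [InnerProductSpace ℂ H]

/-- Nothing is assumed about `e 0`, which is the zero vector for the modes; hence the condition `1 ≤
σ l`. -/
theorem norm_sq_sum_smul {e : ℕ → H} (he : Orthonormal ℂ fun n => e (n + 1)) (s : Finset ℕ)
    (σ : ℕ → ℕ) (hσ : Set.InjOn σ s) (h1 : ∀ l ∈ s, 1 ≤ σ l) (c : ℕ → ℂ) :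
    ‖∑ l ∈ s, c l • e (σ l)‖ ^ 2 = ∑ l ∈ s, ‖c l‖ ^ 2 := by
  have ho : ∀ l ∈ s, ∀ j ∈ s, inner ℂ (e (σ l)) (e (σ j)) = if l = j then (1 : ℂ) else 0 := by
    intro l hl j hj
    have := orthonormal_iff_ite.1 he (σ l - 1) (σ j - 1)
    rw [Nat.sub_add_cancel (h1 l hl), Nat.sub_add_cancel (h1 j hj)] at this
    rw [this]
    have hiff : σ l - 1 = σ j - 1 ↔ l = j := by
      have := h1 l hl
      have := h1 j hj
      constructor
      · intro h; exact hσ hl hj (by omega)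
      · rintro rfl; rfl
    simp only [hiff]
  have h2 : inner ℂ (∑ l ∈ s, c l • e (σ l)) (∑ l ∈ s, c l • e (σ l))
      = ((∑ l ∈ s, ‖c l‖ ^ 2 : ℝ) : ℂ) := by
    rw [sum_inner, Complex.ofReal_sum]
    refine Finset.sum_congr rfl fun l hl => ?_
    rw [inner_sum, Finset.sum_eq_single l]
    · rw [inner_smul_left, inner_smul_right, ho l hl l hl, if_pos rfl, mul_one,
        Complex.conj_mul']
      push_cast; rfl
    · intro j hj hjl
      rw [inner_smul_left, inner_smul_right, ho l hl j hj, if_neg hjl.symm, mul_zero, mul_zero]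
    · exact fun h => absurd hl h
  rw [inner_self_eq_norm_sq_to_K] at h2
  refine Complex.ofReal_injective ?_
  rw [← h2]
  push_cast
  rfl

theorem sum_smul_mem_graph {A : H →ₗ.[ℂ] H} {e : ℕ → H} {lam : ℕ → ℝ}
    (hA : ∀ k, (e k, (Complex.I * lam k) • e k) ∈ A.graph) (s : Finset ℕ) (σ : ℕ → ℕ)
    (c : ℕ → ℂ) :
    (∑ l ∈ s, c l • e (σ l), ∑ l ∈ s, (Complex.I * lam (σ l) * c l) • e (σ l)) ∈ A.graph := by
  have h : (∑ l ∈ s, c l • e (σ l), ∑ l ∈ s, (Complex.I * lam (σ l) * c l) • e (σ l))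
      = ∑ l ∈ s, c l • (e (σ l), (Complex.I * lam (σ l)) • e (σ l)) := by
    rw [Prod.ext_iff]
    constructor
    · simp [Prod.fst_sum]
    · simp only [Prod.snd_sum, Prod.smul_snd, smul_smul]
      exact Finset.sum_congr rfl fun l _ => by rw [mul_comm (c l)]
  rw [h]
  exact Submodule.sum_mem _ fun l _ => Submodule.smul_mem _ _ (hA _)

theorem hasDerivAt_exp_mul_I (x y t : ℝ) :
    HasDerivAt (fun t : ℝ => Complex.exp ((x * t + y : ℝ) * Complex.I))
      (Complex.I * x * Complex.exp ((x * t + y : ℝ) * Complex.I)) t := by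
  have h1 : HasDerivAt (fun t : ℝ => ((x * t + y : ℝ) : ℂ) * Complex.I)
      (((x * 1 : ℝ) : ℂ) * Complex.I) t :=
    ((((hasDerivAt_id t).const_mul x).add_const y).ofReal_comp).mul_const _
  refine h1.cexp.congr_deriv ?_
  simp
  ring

/-- The corrector absorbing one oscillating component of the control, acting along one shift `σ` of
the modes: it solves `W' = A W + (forcing) - (resonant part of the forcing)` up to a small error. -/
theorem exists_corrector {A : H →ₗ.[ℂ] H} {e : ℕ → H} {lam : ℕ → ℝ}
    (he : Orthonormal ℂ fun n => e (n + 1))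
    (hA : ∀ k, (e k, (Complex.I * lam k) • e k) ∈ A.graph) (s : Finset ℕ) (σ : ℕ → ℕ)
    (hσ : Set.InjOn σ s) (h1 : ∀ l ∈ s, 1 ≤ σ l) {θ ω φ δ ρ : ℝ} (hθ : 0 ≤ θ) (hδ : 0 < δ)
    (hD : ∀ l ∈ s, lam l + ω - lam (σ l) = 0 ∨ δ ≤ |lam l + ω - lam (σ l)|)
    {y y' : ℕ → ℝ → ℂ} (hy : ∀ l t, HasDerivAt (y l) (y' l t) t)
    (hy1 : ∀ t, ∑ l ∈ s, ‖y l t‖ ^ 2 ≤ 1) (hρ : 0 ≤ ρ)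
    (hy2 : ∀ t, ∑ l ∈ s, ‖y' l t‖ ^ 2 ≤ ρ ^ 2) :
    ∃ W W' AW : ℝ → H, (∀ t, HasDerivAt W (W' t) t) ∧ (∀ t, (W t, AW t) ∈ A.graph) ∧
      (∀ t, ‖W t‖ ≤ θ / δ) ∧
      ∀ t, ‖W' t - AW t - (∑ l ∈ s, (-(Complex.I * θ) * y l t
            * Complex.exp (((lam l + ω) * t + φ : ℝ) * Complex.I)) • e (σ l)
          - ∑ l ∈ s with lam l + ω - lam (σ l) = 0, (-(Complex.I * θ) * y l t
            * Complex.exp (((lam l + ω) * t + φ : ℝ) * Complex.I)) • e (σ l))‖ ≤ θ / δ * ρ := by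
  set D : ℕ → ℝ := fun l => lam l + ω - lam (σ l) with hDdef
  set E : ℕ → ℝ → ℂ := fun l t => Complex.exp (((lam l + ω) * t + φ : ℝ) * Complex.I) with hE
  have hEd : ∀ l t, HasDerivAt (E l) (Complex.I * ((lam l + ω : ℝ) : ℂ) * E l t) t :=
    fun l t => hasDerivAt_exp_mul_I _ _ _
  have hEn : ∀ l t, ‖E l t‖ = 1 := fun l t => Complex.norm_exp_ofReal_mul_I _
  have hDn : ∀ l ∈ s, ‖(-(θ : ℂ) * ((D l)⁻¹ : ℝ))‖ ≤ θ / δ := by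
    intro l hl
    rw [norm_mul, norm_neg, Complex.norm_real, Complex.norm_real, Real.norm_of_nonneg hθ,
      Real.norm_eq_abs, abs_inv, div_eq_mul_inv]
    refine mul_le_mul_of_nonneg_left ?_ hθ
    -- At a resonance `D l = 0`, and the convention `0⁻¹ = 0` removes that term from the corrector.
    rcases hD l hl with h | h
    · have h' : D l = 0 := h
      rw [h', abs_zero, inv_zero]
      positivity
    · exact inv_anti₀ hδ h
  have hbound : ∀ (z : ℕ → ℝ → ℂ) (r t : ℝ), 0 ≤ r → ∑ l ∈ s, ‖z l t‖ ^ 2 ≤ r ^ 2 →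
      ‖∑ l ∈ s, (-(θ : ℂ) * ((D l)⁻¹ : ℝ) * z l t * E l t) • e (σ l)‖ ≤ θ / δ * r := by
    intro z r t hr hz
    refine abs_le_of_sq_le_sq' ?_ (by positivity) |>.2
    rw [norm_sq_sum_smul he s σ hσ h1 (fun l => -(θ : ℂ) * ((D l)⁻¹ : ℝ) * z l t * E l t),
      mul_pow]
    refine le_trans ?_ (mul_le_mul_of_nonneg_left hz (sq_nonneg _))
    rw [Finset.mul_sum]
    refine Finset.sum_le_sum fun l hl => ?_
    rw [norm_mul, hEn, mul_one, norm_mul, mul_pow]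
    exact mul_le_mul_of_nonneg_right (pow_le_pow_left₀ (norm_nonneg _) (hDn l hl) 2) (sq_nonneg _)
  -- Each coefficient is the forcing divided by `i D l`, as if `y l` were constant. The true
  -- variation of `y l` leaves the remainder with `y' l`.
  refine ⟨fun t => ∑ l ∈ s, (-(θ : ℂ) * ((D l)⁻¹ : ℝ) * y l t * E l t) • e (σ l),
    fun t => ∑ l ∈ s, (-(θ : ℂ) * ((D l)⁻¹ : ℝ) * (y' l t * E l t
      + y l t * (Complex.I * ((lam l + ω : ℝ) : ℂ) * E l t))) • e (σ l),
    fun t => ∑ l ∈ s, (Complex.I * lam (σ l) * (-(θ : ℂ) * ((D l)⁻¹ : ℝ) * y l t * E l t)) • e (σ l),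
    fun t => ?_, fun t => sum_smul_mem_graph hA s σ _, fun t => ?_, fun t => ?_⟩
  · refine HasDerivAt.fun_sum fun l _ => HasDerivAt.smul_const ?_ _
    simpa only [mul_assoc] using ((hy l t).fun_mul (hEd l t)).const_mul (-(θ : ℂ) * ((D l)⁻¹ : ℝ))
  · simpa using hbound y 1 t zero_le_one (by simpa using hy1 t)
  · refine le_trans (le_of_eq ?_) (hbound y' ρ t hρ (hy2 t))
    congr 1
    rw [Finset.sum_filter, ← Finset.sum_sub_distrib, ← Finset.sum_sub_distrib,
      ← Finset.sum_sub_distrib]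
    refine Finset.sum_congr rfl fun l _ => ?_
    have hDl : lam l + ω - lam (σ l) = D l := rfl
    have hDc : (lam (σ l) : ℂ) = lam l + ω - D l := by
      rw [← hDl]; push_cast; ring
    have hEl : Complex.exp (((lam l + ω) * t + φ : ℝ) * Complex.I) = E l t := rfl
    rw [hDl, hDc, hEl]
    split_ifs with h0
    · rw [h0, sub_self, sub_zero, ← sub_smul]
      simp
    · rw [sub_zero, ← sub_smul, ← sub_smul]
      congr 1
      have : (D l : ℂ) ≠ 0 := by exact_mod_cast h0
      push_cast
      field_simp
      ring

/-- The rotation by the angle `x`, with phase `φ`, of the coordinates of indices `k` and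
`k + 1`. -/
noncomputable def rotate (k : ℕ) (φ : ℝ) (c : ℕ → ℂ) (x : ℝ) (l : ℕ) : ℂ :=
  if l = k then Real.cos x * c k - Complex.I * Complex.exp (-φ * Complex.I) * Real.sin x * c (k + 1)
  else if l = k + 1 then
    Real.cos x * c (k + 1) - Complex.I * Complex.exp (φ * Complex.I) * Real.sin x * c k
  else c l

theorem rotate_self (k : ℕ) (φ : ℝ) (c : ℕ → ℂ) (x : ℝ) : rotate k φ c x k
    = Real.cos x * c k - Complex.I * Complex.exp (-φ * Complex.I) * Real.sin x * c (k + 1) := by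
  simp [rotate]

theorem rotate_succ (k : ℕ) (φ : ℝ) (c : ℕ → ℂ) (x : ℝ) : rotate k φ c x (k + 1)
    = Real.cos x * c (k + 1) - Complex.I * Complex.exp (φ * Complex.I) * Real.sin x * c k := by
  simp [rotate]

theorem rotate_of_ne {k l : ℕ} (φ : ℝ) (c : ℕ → ℂ) (x : ℝ) (h1 : l ≠ k) (h2 : l ≠ k + 1) :
    rotate k φ c x l = c l := by
  simp [rotate, h1, h2]

theorem rotate_zero (k : ℕ) (φ : ℝ) (c : ℕ → ℂ) (l : ℕ) : rotate k φ c 0 l = c l := by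
  unfold rotate
  split_ifs with h1 h2 <;> simp [*]

theorem norm_sq_rotate_add (k : ℕ) (φ : ℝ) (c : ℕ → ℂ) (x : ℝ) :
    ‖rotate k φ c x k‖ ^ 2 + ‖rotate k φ c x (k + 1)‖ ^ 2 = ‖c k‖ ^ 2 + ‖c (k + 1)‖ ^ 2 := by
  have h1 : Complex.exp (-φ * Complex.I) * Complex.exp (φ * Complex.I) = 1 := by
    rw [← Complex.exp_add]; simp
  have h2 : ((Real.cos x : ℝ) : ℂ) ^ 2 + ((Real.sin x : ℝ) : ℂ) ^ 2 = 1 := by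
    exact_mod_cast Real.cos_sq_add_sin_sq x
  have h3 : (starRingEnd ℂ) (Complex.exp (-φ * Complex.I)) = Complex.exp (φ * Complex.I) := by
    rw [← Complex.exp_conj]; simp
  have h4 : (starRingEnd ℂ) (Complex.exp (φ * Complex.I)) = Complex.exp (-φ * Complex.I) := by
    rw [← Complex.exp_conj]; simp
  suffices h : ((‖rotate k φ c x k‖ ^ 2 + ‖rotate k φ c x (k + 1)‖ ^ 2 : ℝ) : ℂ)
      = ((‖c k‖ ^ 2 + ‖c (k + 1)‖ ^ 2 : ℝ) : ℂ) by exact_mod_cast h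
  push_cast
  rw [← Complex.mul_conj', ← Complex.mul_conj', ← Complex.mul_conj', ← Complex.mul_conj',
    rotate_self, rotate_succ]
  simp only [map_sub, map_mul, h3, h4, Complex.conj_I, Complex.conj_ofReal]
  generalize Complex.exp (-φ * Complex.I) = F at *
  generalize Complex.exp (φ * Complex.I) = G at *
  generalize ((Real.cos x : ℝ) : ℂ) = C at *
  generalize ((Real.sin x : ℝ) : ℂ) = S at *
  linear_combination (c k * (starRingEnd ℂ) (c k) + c (k + 1) * (starRingEnd ℂ) (c (k + 1))) *
    (h2 + S ^ 2 * h1 - S ^ 2 * F * G * Complex.I_sq)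

theorem sum_norm_sq_rotate {m k : ℕ} (hmk : m ≤ k) (φ : ℝ) (c : ℕ → ℂ) (x : ℝ) :
    ∑ l ∈ Finset.Icc m (k + 1), ‖rotate k φ c x l‖ ^ 2
      = ∑ l ∈ Finset.Icc m (k + 1), ‖c l‖ ^ 2 := by
  obtain ⟨j, rfl⟩ : ∃ j, k = m + j := ⟨k - m, by omega⟩
  have h : ∀ f : ℕ → ℝ, ∑ l ∈ Finset.Icc m (m + j + 1), f l
      = ∑ l ∈ Finset.Ico m (m + j), f l + (f (m + j) + f (m + j + 1)) := by
    intro f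
    rw [← Finset.Ico_add_one_right_eq_Icc, Finset.sum_Ico_succ_top (by omega),
      Finset.sum_Ico_succ_top (by omega), add_assoc]
  rw [h, h, norm_sq_rotate_add]
  congr 1
  refine Finset.sum_congr rfl fun l hl => ?_
  rw [Finset.mem_Ico] at hl
  rw [rotate_of_ne _ _ _ (by omega) (by omega)]

theorem hasDerivAt_rotate_self (k : ℕ) (φ : ℝ) (c : ℕ → ℂ) (θ t : ℝ) :
    HasDerivAt (fun t => rotate k φ c (θ * t) k)
      (-(Complex.I * θ) * Complex.exp (-φ * Complex.I) * rotate k φ c (θ * t) (k + 1)) t := by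
  simp_rw [rotate_self, rotate_succ]
  have h0 : HasDerivAt (fun t => θ * t) θ t := by simpa using (hasDerivAt_id t).const_mul θ
  have hc := (h0.cos.ofReal_comp).mul_const (c k)
  have hs := (h0.sin.ofReal_comp).const_mul (Complex.I * Complex.exp (-φ * Complex.I))
  refine (hc.sub (hs.mul_const (c (k + 1)))).congr_deriv ?_
  have h1 : Complex.exp (-φ * Complex.I) * Complex.exp (φ * Complex.I) = 1 := by
    rw [← Complex.exp_add]; simp
  push_cast
  linear_combination (-Complex.I ^ 2 * θ * Complex.sin (θ * t) * c k) * h1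
    - θ * Complex.sin (θ * t) * c k * Complex.I_sq

theorem hasDerivAt_rotate_succ (k : ℕ) (φ : ℝ) (c : ℕ → ℂ) (θ t : ℝ) :
    HasDerivAt (fun t => rotate k φ c (θ * t) (k + 1))
      (-(Complex.I * θ) * Complex.exp (φ * Complex.I) * rotate k φ c (θ * t) k) t := by
  simp_rw [rotate_self, rotate_succ]
  have h0 : HasDerivAt (fun t => θ * t) θ t := by simpa using (hasDerivAt_id t).const_mul θ
  have hc := (h0.cos.ofReal_comp).mul_const (c (k + 1))
  have hs := (h0.sin.ofReal_comp).const_mul (Complex.I * Complex.exp (φ * Complex.I))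
  refine (hc.sub (hs.mul_const (c k))).congr_deriv ?_
  have h1 : Complex.exp (-φ * Complex.I) * Complex.exp (φ * Complex.I) = 1 := by
    rw [← Complex.exp_add]; simp
  push_cast
  linear_combination (-Complex.I ^ 2 * θ * Complex.sin (θ * t) * c (k + 1)) * h1
    - θ * Complex.sin (θ * t) * c (k + 1) * Complex.I_sq

end Pulse

/-! ### The effect of a resonant pulse -/

section PulseTheorem

variable {H : Type*} [NormedAddCommGroup H] [InnerProductSpace ℂ H]

theorem ApproxSteers.of_norm_sub_le {A : H →ₗ.[ℂ] H} {B : H →ₗ[ℂ] H} {E : ℝ} {ψ ψ' : H}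
    (h : ‖ψ - ψ'‖ ≤ E) : ApproxSteers A B 0 E ψ ψ' := fun η hη =>
  ⟨[], ψ, rfl, Steers.nil ψ, by linarith⟩

/-- The derivative of `rotate`. -/
noncomputable def rotateDeriv (k : ℕ) (φ θ : ℝ) (c : ℕ → ℂ) (l : ℕ) (t : ℝ) : ℂ :=
  if l = k then -(Complex.I * θ) * Complex.exp (-φ * Complex.I) * rotate k φ c (θ * t) (k + 1)
  else if l = k + 1 then -(Complex.I * θ) * Complex.exp (φ * Complex.I) * rotate k φ c (θ * t) k
  else 0

theorem rotateDeriv_self (k : ℕ) (φ θ : ℝ) (c : ℕ → ℂ) (t : ℝ) : rotateDeriv k φ θ c k t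
    = -(Complex.I * θ) * Complex.exp (-φ * Complex.I) * rotate k φ c (θ * t) (k + 1) := by
  simp [rotateDeriv]

theorem rotateDeriv_succ (k : ℕ) (φ θ : ℝ) (c : ℕ → ℂ) (t : ℝ) : rotateDeriv k φ θ c (k + 1) t
    = -(Complex.I * θ) * Complex.exp (φ * Complex.I) * rotate k φ c (θ * t) k := by
  simp [rotateDeriv]

theorem rotateDeriv_of_ne {k l : ℕ} (φ θ : ℝ) (c : ℕ → ℂ) (t : ℝ) (h1 : l ≠ k) (h2 : l ≠ k + 1) :
    rotateDeriv k φ θ c l t = 0 := by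
  simp [rotateDeriv, h1, h2]

theorem hasDerivAt_rotate (k : ℕ) (φ θ : ℝ) (c : ℕ → ℂ) (l : ℕ) (t : ℝ) :
    HasDerivAt (fun t => rotate k φ c (θ * t) l) (rotateDeriv k φ θ c l t) t := by
  rcases eq_or_ne l k with rfl | h1
  · rw [rotateDeriv_self]; exact hasDerivAt_rotate_self l φ c θ t
  · rcases eq_or_ne l (k + 1) with rfl | h2
    · rw [rotateDeriv_succ]; exact hasDerivAt_rotate_succ k φ c θ t
    · rw [rotateDeriv_of_ne _ _ _ _ h1 h2]
      simp_rw [rotate_of_ne φ c _ h1 h2]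
      exact hasDerivAt_const t _

theorem sum_Icc_eq_add_add {M : Type*} [AddCommMonoid M] {m k : ℕ} (hmk : m ≤ k) (f : ℕ → M)
    (hf : ∀ l, l ≠ k → l ≠ k + 1 → f l = 0) :
    ∑ l ∈ Finset.Icc m (k + 1), f l = f k + f (k + 1) := by
  rw [← Finset.sum_subset (s₁ := {k, k + 1})]
  · rw [Finset.sum_pair (by omega)]
  · intro l hl
    simp only [Finset.mem_insert, Finset.mem_singleton] at hl
    rw [Finset.mem_Icc]; omega
  · intro l _ hl
    simp only [Finset.mem_insert, Finset.mem_singleton, not_or] at hl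
    exact hf l hl.1 hl.2

theorem sum_norm_sq_rotateDeriv_le {m k : ℕ} (hmk : m ≤ k) (φ θ : ℝ) (c : ℕ → ℂ)
    (hc : ∑ l ∈ Finset.Icc m (k + 1), ‖c l‖ ^ 2 ≤ 1) (t : ℝ) :
    ∑ l ∈ Finset.Icc m (k + 1), ‖rotateDeriv k φ θ c l t‖ ^ 2 ≤ θ ^ 2 := by
  rw [sum_Icc_eq_add_add hmk (fun l => ‖rotateDeriv k φ θ c l t‖ ^ 2)
    (fun l h1 h2 => by rw [rotateDeriv_of_ne _ _ _ _ h1 h2]; simp), rotateDeriv_self,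
    rotateDeriv_succ]
  have h1 : ‖Complex.exp (φ * Complex.I)‖ = 1 := Complex.norm_exp_ofReal_mul_I φ
  have h2 : ‖Complex.exp (-φ * Complex.I)‖ = 1 := by
    have := Complex.norm_exp_ofReal_mul_I (-φ)
    rwa [Complex.ofReal_neg] at this
  rw [norm_mul, norm_mul, norm_mul, norm_mul, h1, h2, norm_neg, norm_mul, Complex.norm_I,
    Complex.norm_real, one_mul, mul_one, mul_pow, mul_pow, ← mul_add, Real.norm_eq_abs, sq_abs]
  have h3 : ‖rotate k φ c (θ * t) (k + 1)‖ ^ 2 + ‖rotate k φ c (θ * t) k‖ ^ 2 ≤ 1 := by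
    rw [add_comm]
    refine le_trans ?_ ((sum_norm_sq_rotate hmk φ c (θ * t)).trans_le hc)
    rw [← Finset.sum_pair (f := fun l => ‖rotate k φ c (θ * t) l‖ ^ 2) (by omega : k ≠ k + 1)]
    refine Finset.sum_le_sum_of_subset_of_nonneg ?_ fun _ _ _ => sq_nonneg _
    intro l hl
    simp only [Finset.mem_insert, Finset.mem_singleton] at hl
    rw [Finset.mem_Icc]; omega
  nlinarith [sq_nonneg θ]

/-- A resonant pulse rotates the coordinates of indices `k` and `k + 1`, in the interaction
picture; the error is inversely proportional to the duration of the pulse and to the spectral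
gap. -/
theorem approxSteers_pulse {A : H →ₗ.[ℂ] H} {B : H →ₗ[ℂ] H} {e : ℕ → H} {lam : ℕ → ℝ}
    (he : Orthonormal ℂ fun n => e (n + 1))
    (hA : ∀ k, (e k, (Complex.I * lam k) • e k) ∈ A.graph)
    (hBe : ∀ k, 1 ≤ k → B (e k) = (-(Complex.I / 2)) • (e (k + 1) + e (k - 1)))
    (hB : ∀ x, ‖B x‖ ≤ ‖x‖) (hgen : ∀ v : ℝ, ∃ U, IsUnitaryGroupOf (((v : ℂ) • B) +ᵥ A) U)
    {m k : ℕ} (hm : 2 ≤ m) (hmk : m ≤ k) {δ : ℝ} (hδ : 0 < δ)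
    (hmono : ∀ l, lam l ≤ lam (l + 1)) (hk : δ ≤ lam (k + 1) - lam k)
    (hgap : ∀ l, l ≤ k + 1 → l ≠ k → δ ≤ |(lam (l + 1) - lam l) - (lam (k + 1) - lam k)|)
    {c : ℕ → ℂ} (hc : ∑ l ∈ Finset.Icc m (k + 1), ‖c l‖ ^ 2 ≤ 1) {T x : ℝ} (hT : 0 < T)
    (hx0 : 0 ≤ x) (hx1 : x ≤ π / 2) (φ : ℝ) :
    ApproxSteers A B T (64 / (T * δ)) (∑ l ∈ Finset.Icc m (k + 1), c l • e l)
      (∑ l ∈ Finset.Icc m (k + 1),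
        (rotate k φ c x l * Complex.exp ((lam l * T : ℝ) * Complex.I)) • e l) := by
  set s := Finset.Icc m (k + 1) with hs
  have hmem : ∀ l ∈ s, m ≤ l ∧ l ≤ k + 1 := fun l hl => Finset.mem_Icc.1 hl
  obtain ⟨θ, hθdef⟩ : ∃ θ, θ = x / T := ⟨_, rfl⟩
  have hθ : 0 ≤ θ := by rw [hθdef]; positivity
  have hθT : θ * T = x := by rw [hθdef]; field_simp
  obtain ⟨ω, hω⟩ : ∃ ω, ω = lam (k + 1) - lam k := ⟨_, rfl⟩
  obtain ⟨y, hydef⟩ : ∃ y : ℕ → ℝ → ℂ, y = fun l t => rotate k φ c (θ * t) l := ⟨_, rfl⟩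
  obtain ⟨y', hy'def⟩ : ∃ y' : ℕ → ℝ → ℂ, y' = rotateDeriv k φ θ c := ⟨_, rfl⟩
  have hy : ∀ l t, HasDerivAt (y l) (y' l t) t := fun l t => by
    rw [hydef, hy'def]; exact hasDerivAt_rotate k φ θ c l t
  have hy1 : ∀ t, ∑ l ∈ s, ‖y l t‖ ^ 2 ≤ 1 := fun t => by
    rw [hydef]; exact (sum_norm_sq_rotate hmk φ c (θ * t)).trans_le hc
  have hy2 : ∀ t, ∑ l ∈ s, ‖y' l t‖ ^ 2 ≤ θ ^ 2 := fun t => by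
    rw [hy'def]; exact sum_norm_sq_rotateDeriv_le hmk φ θ c hc t
  -- detunings along the two shifts
  have hup : ∀ l, lam l + ω - lam (l + 1) = -((lam (l + 1) - lam l) - (lam (k + 1) - lam k)) := by
    intro l; rw [hω]; ring
  have hup0 : ∀ l, l = k → lam l + ω - lam (l + 1) = 0 := by
    rintro l rfl; rw [hω]; ring
  have hup1 : ∀ l ∈ s, l ≠ k → δ ≤ |lam l + ω - lam (l + 1)| := by
    intro l hl hlk
    rw [hup, abs_neg]
    exact hgap l (hmem l hl).2 hlk
  have hup2 : ∀ l ∈ s, δ ≤ |lam l + -ω - lam (l + 1)| := by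
    intro l _
    have := hmono l
    rw [abs_of_nonpos (by linarith)]
    linarith
  have hdn : ∀ l ∈ s, lam (l - 1) ≤ lam l := by
    intro l hl
    have h1 := hmono (l - 1)
    rwa [Nat.sub_add_cancel (by linarith [(hmem l hl).1])] at h1
  have hdn0 : ∀ l, l = k + 1 → lam l + -ω - lam (l - 1) = 0 := by
    rintro l rfl; rw [hω, Nat.add_sub_cancel]; ring
  have hdn1 : ∀ l ∈ s, l ≠ k + 1 → δ ≤ |lam l + -ω - lam (l - 1)| := by
    intro l hl hlk
    have h1 := hgap (l - 1) (by have := (hmem l hl).2; omega) (by have := (hmem l hl).1; omega)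
    rw [Nat.sub_add_cancel (by linarith [(hmem l hl).1])] at h1
    refine h1.trans_eq (congrArg _ ?_)
    rw [hω]; ring
  have hdn2 : ∀ l ∈ s, δ ≤ |lam l + ω - lam (l - 1)| := by
    intro l hl
    have := hdn l hl
    rw [abs_of_nonneg (by linarith)]
    linarith
  have hσ1 : Set.InjOn (fun l => l + 1) (s : Set ℕ) := fun a _ b _ h => by simpa using h
  have hσ2 : Set.InjOn (fun l => l - 1) (s : Set ℕ) := fun a ha b hb h => by
    have h1 := (hmem a ha).1
    have h2 := (hmem b hb).1
    simp only at h
    omega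
  have h11 : ∀ l ∈ s, 1 ≤ l + 1 := fun l _ => by omega
  have h12 : ∀ l ∈ s, 1 ≤ l - 1 := fun l hl => by have := (hmem l hl).1; omega
  -- One corrector for each sign of the frequency and each direction of the shift. `W1` and `W4`
  -- each leave one resonant term, at `l = k` and `l = k + 1`; the counter-rotating `W2` and `W3`
  -- leave none.
  obtain ⟨W1, W1', V1, hd1, hg1, hn1, hr1⟩ := exists_corrector he hA s (fun l => l + 1) hσ1 h11
    (ω := ω) (φ := φ) hθ hδ (fun l hl => by
      by_cases h : l = k
      · exact Or.inl (hup0 l h)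
      · exact Or.inr (hup1 l hl h)) hy hy1 hθ hy2
  obtain ⟨W2, W2', V2, hd2, hg2, hn2, hr2⟩ := exists_corrector he hA s (fun l => l + 1) hσ1 h11
    (ω := -ω) (φ := -φ) hθ hδ (fun l hl => Or.inr (hup2 l hl)) hy hy1 hθ hy2
  obtain ⟨W3, W3', V3, hd3, hg3, hn3, hr3⟩ := exists_corrector he hA s (fun l => l - 1) hσ2 h12
    (ω := ω) (φ := φ) hθ hδ (fun l hl => Or.inr (hdn2 l hl)) hy hy1 hθ hy2
  obtain ⟨W4, W4', V4, hd4, hg4, hn4, hr4⟩ := exists_corrector he hA s (fun l => l - 1) hσ2 h12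
    (ω := -ω) (φ := -φ) hθ hδ (fun l hl => by
      by_cases h : l = k + 1
      · exact Or.inl (hdn0 l h)
      · exact Or.inr (hdn1 l hl h)) hy hy1 hθ hy2
  have hks : k ∈ s := Finset.mem_Icc.2 ⟨hmk, by omega⟩
  have hks' : k + 1 ∈ s := Finset.mem_Icc.2 ⟨by omega, le_rfl⟩
  have hf1 : (s.filter fun l => lam l + ω - lam (l + 1) = 0) = {k} := by
    ext l
    rw [Finset.mem_filter, Finset.mem_singleton]
    refine ⟨fun h => ?_, fun h => ⟨h ▸ hks, hup0 l h⟩⟩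
    by_contra hne
    have := hup1 l h.1 hne
    rw [h.2, abs_zero] at this
    linarith
  have hf2 : (s.filter fun l => lam l + -ω - lam (l + 1) = 0) = ∅ := by
    refine Finset.filter_eq_empty_iff.2 fun l hl h => ?_
    have := hup2 l hl
    rw [h, abs_zero] at this
    linarith
  have hf3 : (s.filter fun l => lam l + ω - lam (l - 1) = 0) = ∅ := by
    refine Finset.filter_eq_empty_iff.2 fun l hl h => ?_
    have := hdn2 l hl
    rw [h, abs_zero] at this
    linarith
  have hf4 : (s.filter fun l => lam l + -ω - lam (l - 1) = 0) = {k + 1} := by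
    ext l
    rw [Finset.mem_filter, Finset.mem_singleton]
    refine ⟨fun h => ?_, fun h => ⟨h ▸ hks', hdn0 l h⟩⟩
    by_contra hne
    have := hdn1 l h.1 hne
    rw [h.2, abs_zero] at this
    linarith
  simp only [hf1, Finset.sum_singleton] at hr1
  simp only [hf2, Finset.sum_empty, sub_zero] at hr2
  simp only [hf3, Finset.sum_empty, sub_zero] at hr3
  simp only [hf4, Finset.sum_singleton, Nat.add_sub_cancel] at hr4
  -- the leading part of the trajectory
  obtain ⟨E, hE⟩ : ∃ E : ℕ → ℝ → ℂ, E = fun l t =>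
    Complex.exp ((lam l * t + 0 : ℝ) * Complex.I) := ⟨_, rfl⟩
  have hEd : ∀ l t, HasDerivAt (E l) (Complex.I * lam l * E l t) t := fun l t => by
    rw [hE]; exact hasDerivAt_exp_mul_I _ _ _
  have hEn : ∀ l t, ‖E l t‖ = 1 := fun l t => by rw [hE]; exact Complex.norm_exp_ofReal_mul_I _
  obtain ⟨p, hp⟩ : ∃ p : ℝ → H, p = fun t => ∑ l ∈ s, (y l t * E l t) • e l := ⟨_, rfl⟩
  obtain ⟨p', hp'⟩ : ∃ p' : ℝ → H, p' = fun t => ∑ l ∈ s, (y' l t * E l t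
    + y l t * (Complex.I * lam l * E l t)) • e l := ⟨_, rfl⟩
  obtain ⟨V, hV⟩ : ∃ V : ℝ → H, V = fun t => ∑ l ∈ s, (Complex.I * lam l * (y l t * E l t)) • e l :=
    ⟨_, rfl⟩
  have hpd : ∀ t, HasDerivAt p (p' t) t := fun t => by
    rw [hp, hp']
    exact HasDerivAt.fun_sum fun l _ => ((hy l t).fun_mul (hEd l t)).smul_const _
  have hpg : ∀ t, (p t, V t) ∈ A.graph := fun t => by
    rw [hp, hV]
    exact sum_smul_mem_graph hA s (fun l => l) _
  have hpn : ∀ t, ‖p t‖ ≤ 1 := fun t => by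
    rw [hp]
    refine abs_le_of_sq_le_sq' ?_ zero_le_one |>.2
    have := norm_sq_sum_smul he s (fun l => l) (fun a _ b _ h => h)
      (fun l hl => by have := (hmem l hl).1; omega) (fun l => y l t * E l t)
    rw [this, one_pow]
    refine le_trans (le_of_eq (Finset.sum_congr rfl fun l _ => ?_)) (hy1 t)
    rw [norm_mul, hEn, mul_one]
  -- The factor `4` offsets the halves coming from the cosine and from the matrix entries `-i/2` of
  -- `B`, so each exponential carries `-iθ`.
  obtain ⟨u, hu⟩ : ∃ u : ℝ → ℝ, u = fun t => 4 * θ * Real.cos (ω * t + φ) := ⟨_, rfl⟩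
  have hun : ∀ t, |u t| ≤ 4 * θ := fun t => by
    rw [hu]
    simp only
    rw [abs_mul, abs_of_nonneg (by positivity : 0 ≤ 4 * θ)]
    exact mul_le_of_le_one_right (by positivity) (Real.abs_cos_le_one _)
  -- The ideal rotation is driven exactly by the two resonant terms excluded from the correctors.
  have hres : ∀ t, p' t - V t
      = (-(Complex.I * θ) * y k t * Complex.exp (((lam k + ω) * t + φ : ℝ) * Complex.I)) • e (k + 1)
        + (-(Complex.I * θ) * y (k + 1) t
          * Complex.exp (((lam (k + 1) + -ω) * t + -φ : ℝ) * Complex.I)) • e k := by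
    intro t
    have h1 : p' t - V t = ∑ l ∈ s, (y' l t * E l t) • e l := by
      rw [hp', hV]
      simp only
      rw [← Finset.sum_sub_distrib]
      refine Finset.sum_congr rfl fun l _ => ?_
      rw [← sub_smul]
      congr 1
      ring
    rw [h1, sum_Icc_eq_add_add hmk _ (fun l h1 h2 => by
      rw [hy'def, rotateDeriv_of_ne _ _ _ _ h1 h2, zero_mul, zero_smul]), add_comm]
    rw [hy'def, hydef, hE, rotateDeriv_self, rotateDeriv_succ]
    have e1 : lam k + ω = lam (k + 1) := by rw [hω]; ring
    have e2 : lam (k + 1) + -ω = lam k := by rw [hω]; ring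
    rw [e1, e2]
    have e3 : ∀ a b : ℝ, Complex.exp ((a * t + b : ℝ) * Complex.I)
        = Complex.exp (b * Complex.I) * Complex.exp ((a * t + 0 : ℝ) * Complex.I) := by
      intro a b
      rw [← Complex.exp_add]
      push_cast
      ring_nf
    rw [e3 _ φ, e3 _ (-φ)]
    congr 2
    · ring
    · push_cast; ring
  have hforce : ∀ t, (u t : ℂ) • B (p t)
      = ∑ l ∈ s, (-(Complex.I * θ) * y l t
            * Complex.exp (((lam l + ω) * t + φ : ℝ) * Complex.I)) • e (l + 1)
        + ∑ l ∈ s, (-(Complex.I * θ) * y l t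
            * Complex.exp (((lam l + -ω) * t + -φ : ℝ) * Complex.I)) • e (l + 1)
        + ∑ l ∈ s, (-(Complex.I * θ) * y l t
            * Complex.exp (((lam l + ω) * t + φ : ℝ) * Complex.I)) • e (l - 1)
        + ∑ l ∈ s, (-(Complex.I * θ) * y l t
            * Complex.exp (((lam l + -ω) * t + -φ : ℝ) * Complex.I)) • e (l - 1) := by
    intro t
    rw [hp]
    simp only
    rw [map_sum, Finset.smul_sum, ← Finset.sum_add_distrib, ← Finset.sum_add_distrib,
      ← Finset.sum_add_distrib]
    refine Finset.sum_congr rfl fun l hl => ?_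
    rw [map_smul, hBe l (by have := (hmem l hl).1; omega)]
    have hcos : (u t : ℂ) = 2 * θ * (Complex.exp ((ω * t + φ : ℝ) * Complex.I)
        + Complex.exp (-((ω * t + φ : ℝ) * Complex.I))) := by
      rw [hu]
      push_cast
      rw [Complex.cos, neg_mul]
      ring
    have e1 : Complex.exp (((lam l + ω) * t + φ : ℝ) * Complex.I)
        = E l t * Complex.exp ((ω * t + φ : ℝ) * Complex.I) := by
      rw [hE, ← Complex.exp_add]; push_cast; ring_nf
    have e2 : Complex.exp (((lam l + -ω) * t + -φ : ℝ) * Complex.I)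
        = E l t * Complex.exp (-((ω * t + φ : ℝ) * Complex.I)) := by
      rw [hE, ← Complex.exp_add]; push_cast; ring_nf
    rw [e1, e2, hcos]
    module
  have hWn : ∀ t, ‖W1 t + W2 t + W3 t + W4 t‖ ≤ 4 * θ / δ := fun t => by
    refine (norm_add_le _ _).trans ?_
    have := norm_add₃_le (a := W1 t) (b := W2 t) (c := W3 t)
    have e1 : 4 * θ / δ = θ / δ + θ / δ + θ / δ + θ / δ := by ring
    linarith [hn1 t, hn2 t, hn3 t, hn4 t]
  -- The defect `20 θ²/δ` consists of four corrector remainders `θ²/δ` and of the control acting on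
  -- the correctors, at most `4θ · 4θ/δ`.
  have key := approxSteers_of_approx (A := A) (B := B) hgen hB (η := 20 * θ ^ 2 / δ)
    (K := 4 * θ * |ω|) (M := 1 + 4 * θ / δ) hT
    (q := fun t => p t + (W1 t + W2 t + W3 t + W4 t))
    (q' := fun t => p' t + (W1' t + W2' t + W3' t + W4' t))
    (a := fun t => V t + (V1 t + V2 t + V3 t + V4 t)) (u := u)
    (fun t₁ t₂ => by
      rw [hu]
      simp only
      rw [← mul_sub, abs_mul, abs_of_nonneg (by positivity : 0 ≤ 4 * θ), mul_assoc (4 * θ)]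
      refine mul_le_mul_of_nonneg_left ((Real.abs_cos_sub_cos_le _ _).trans_eq ?_) (by positivity)
      rw [← abs_mul]; ring_nf)
    (fun t => (norm_add_le _ _).trans (add_le_add (hpn t) (hWn t)))
    (fun t => (hpd t).add ((((hd1 t).add (hd2 t)).add (hd3 t)).add (hd4 t)))
    (fun t => A.graph.add_mem (hpg t) (A.graph.add_mem (A.graph.add_mem
      (A.graph.add_mem (hg1 t) (hg2 t)) (hg3 t)) (hg4 t)))
    (fun t => by
      have hBW : ‖(u t : ℂ) • B (W1 t + W2 t + W3 t + W4 t)‖ ≤ 4 * θ * (4 * θ / δ) := by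
        rw [norm_smul, Complex.norm_real]
        exact mul_le_mul (hun t) ((hB _).trans (hWn t)) (norm_nonneg _) (by positivity)
      have h1 := hr1 t
      have h2 := hr2 t
      have h3 := hr3 t
      have h4 := hr4 t
      have h5 := hres t
      have h6 := hforce t
      generalize (-(Complex.I * θ) * y k t
        * Complex.exp (((lam k + ω) * t + φ : ℝ) * Complex.I)) • e (k + 1) = R1 at *
      generalize (-(Complex.I * θ) * y (k + 1) t
        * Complex.exp (((lam (k + 1) + -ω) * t + -φ : ℝ) * Complex.I)) • e k = R4 at *
      generalize ∑ l ∈ s, (-(Complex.I * θ) * y l t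
        * Complex.exp (((lam l + ω) * t + φ : ℝ) * Complex.I)) • e (l + 1) = F1 at *
      generalize ∑ l ∈ s, (-(Complex.I * θ) * y l t
        * Complex.exp (((lam l + -ω) * t + -φ : ℝ) * Complex.I)) • e (l + 1) = F2 at *
      generalize ∑ l ∈ s, (-(Complex.I * θ) * y l t
        * Complex.exp (((lam l + ω) * t + φ : ℝ) * Complex.I)) • e (l - 1) = F3 at *
      generalize ∑ l ∈ s, (-(Complex.I * θ) * y l t
        * Complex.exp (((lam l + -ω) * t + -φ : ℝ) * Complex.I)) • e (l - 1) = F4 at *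
      have e1 : p' t + (W1' t + W2' t + W3' t + W4' t) - (V t + (V1 t + V2 t + V3 t + V4 t)
          + (u t : ℂ) • B (p t + (W1 t + W2 t + W3 t + W4 t)))
          = (W1' t - V1 t - (F1 - R1)) + (W2' t - V2 t - F2) + (W3' t - V3 t - F3)
            + (W4' t - V4 t - (F4 - R4)) - (u t : ℂ) • B (W1 t + W2 t + W3 t + W4 t) := by
        rw [map_add B (p t), smul_add, h6, eq_add_of_sub_eq h5]
        abel
      rw [e1]
      refine (norm_sub_le _ _).trans ?_
      have h7 := norm_add_le ((W1' t - V1 t - (F1 - R1)) + (W2' t - V2 t - F2)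
        + (W3' t - V3 t - F3)) (W4' t - V4 t - (F4 - R4))
      have h8 := norm_add₃_le (a := W1' t - V1 t - (F1 - R1)) (b := W2' t - V2 t - F2)
        (c := W3' t - V3 t - F3)
      have e2 : 20 * θ ^ 2 / δ = 4 * (θ / δ * θ) + 4 * θ * (4 * θ / δ) := by ring
      linarith)
  have hstart : ApproxSteers A B 0 (4 * θ / δ) (∑ l ∈ s, c l • e l)
      (p 0 + (W1 0 + W2 0 + W3 0 + W4 0)) := by
    refine ApproxSteers.of_norm_sub_le ?_
    have e1 : ∑ l ∈ s, c l • e l = p 0 := by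
      rw [hp, hydef, hE]
      refine Finset.sum_congr rfl fun l _ => ?_
      simp only [mul_zero, rotate_zero]
      simp
    rw [e1, sub_add_cancel_left, norm_neg]
    exact hWn 0
  have hend : ApproxSteers A B 0 (4 * θ / δ) (p T + (W1 T + W2 T + W3 T + W4 T))
      (∑ l ∈ s, (rotate k φ c x l * Complex.exp ((lam l * T : ℝ) * Complex.I)) • e l) := by
    refine ApproxSteers.of_norm_sub_le ?_
    have e1 : ∑ l ∈ s, (rotate k φ c x l * Complex.exp ((lam l * T : ℝ) * Complex.I)) • e l
        = p T := by
      rw [hp, hydef, hE]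
      refine Finset.sum_congr rfl fun l _ => ?_
      simp only
      rw [hθT, add_zero]
    rw [e1, add_sub_cancel_left]
    exact hWn T
  have hall := (hstart.trans key).trans hend
  rw [zero_add, add_zero] at hall
  refine hall.mono ?_
  have e1 : 4 * θ / δ + 20 * θ ^ 2 / δ * T + 4 * θ / δ = x * (8 + 20 * x) / (T * δ) := by
    rw [hθdef]; field_simp; ring
  rw [e1]
  refine div_le_div_of_nonneg_right ?_ (by positivity)
  -- Adding the corrector at both ends, the error is `x(8 + 20x)/(Tδ)`, and `x(8 + 20x) ≤ 64` for `x
  -- ≤ 1.571`.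
  have hx2 : x ≤ 1.571 := by linarith [Real.pi_lt_d4]
  nlinarith

end PulseTheorem

/-! ### Estimates on powers -/

/-- Telescoping of `r n^(-(r+1)) ≤ (n-1)^(-r) - n^(-r)`, which is the inequality `(1 - 1/n)^(-r) ≥ 1
+ r/n` multiplied by `n^(-r)`. -/
theorem sum_rpow_le {m : ℕ} (hm : 2 ≤ m) {r : ℝ} (hr : 0 < r) (j : ℕ) :
    ∑ i ∈ Finset.range j, ((m + i : ℕ) : ℝ) ^ (-(r + 1)) ≤ ((m : ℝ) - 1) ^ (-r) / r := by
  have step : ∀ n : ℝ, 1 < n → r * n ^ (-(r + 1)) ≤ (n - 1) ^ (-r) - n ^ (-r) := by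
    intro n hn
    have hn0 : 0 < n := by linarith
    have h1 : n ^ (-(r + 1)) = n ^ (-r) * n⁻¹ := by
      rw [neg_add, ← sub_eq_add_neg, Real.rpow_sub_one hn0.ne', div_eq_mul_inv]
    have h2 : (n - 1) ^ (-r) = n ^ (-r) * (1 - n⁻¹) ^ (-r) := by
      have hinv : n⁻¹ < 1 := inv_lt_one_of_one_lt₀ hn
      rw [← Real.mul_rpow hn0.le (by linarith)]
      congr 1
      field_simp
    have h3 : 1 + r * n⁻¹ ≤ (1 - n⁻¹) ^ (-r) := by
      have hinv : n⁻¹ < 1 := inv_lt_one_of_one_lt₀ hn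
      rw [Real.rpow_def_of_pos (by linarith)]
      have h4 := Real.log_le_sub_one_of_pos (x := 1 - n⁻¹) (by linarith)
      have h5 := Real.add_one_le_exp (Real.log (1 - n⁻¹) * -r)
      nlinarith
    rw [h1, h2]
    have h4 : 0 < n ^ (-r) := Real.rpow_pos_of_pos hn0 _
    nlinarith
  have hsum : ∀ j : ℕ, r * ∑ i ∈ Finset.range j, ((m + i : ℕ) : ℝ) ^ (-(r + 1))
      ≤ ((m : ℝ) - 1) ^ (-r) - (((m + j : ℕ) : ℝ) - 1) ^ (-r) := by
    intro j
    induction j with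
    | zero => simp
    | succ j ih =>
      rw [Finset.sum_range_succ, mul_add]
      have hm' : (2 : ℝ) ≤ m := by exact_mod_cast hm
      have h1 := step ((m + j : ℕ) : ℝ) (by push_cast; nlinarith [(Nat.cast_nonneg j : (0:ℝ) ≤ j)])
      have h2 : ((m + (j + 1) : ℕ) : ℝ) - 1 = ((m + j : ℕ) : ℝ) := by push_cast; ring
      rw [h2]
      linarith
  rw [le_div_iff₀ hr, mul_comm]
  refine (hsum j).trans ?_
  have hm' : (2 : ℝ) ≤ m := by exact_mod_cast hm
  have : 0 ≤ (((m + j : ℕ) : ℝ) - 1) ^ (-r) := by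
    refine Real.rpow_nonneg ?_ _
    push_cast
    nlinarith [(Nat.cast_nonneg j : (0:ℝ) ≤ j)]
  linarith

/-- With `x = 1/k`, `u = (1+x)^α` and `v = (1-x)^α`, the claim becomes `u² + v² - 2 ≥ α²x²`. Write
the left side as `(u-v)² + 2(uv - 1)`: Bernoulli gives `u - v ≥ (α+1)x` and `uv = (1-x²)^α ≥ 1 -
αx²`, for a total of at least `(α²+1)x²`. -/
theorem rpow_second_difference {α : ℝ} (hα : 1 ≤ α) {k : ℕ} (hk : 1 ≤ k) :
    α ^ 2 * (k : ℝ) ^ (2 * α - 2) ≤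
      (((k + 1 : ℕ) : ℝ) ^ (2 * α) - (k : ℝ) ^ (2 * α))
        - ((k : ℝ) ^ (2 * α) - ((k - 1 : ℕ) : ℝ) ^ (2 * α)) := by
  have hk' : (1 : ℝ) ≤ k := by exact_mod_cast hk
  have hk0 : (0 : ℝ) < k := by linarith
  obtain ⟨x, hx⟩ : ∃ x : ℝ, x = (k : ℝ)⁻¹ := ⟨_, rfl⟩
  have hx0 : 0 < x := by rw [hx]; positivity
  have hx1 : x ≤ 1 := by rw [hx]; exact inv_le_one_of_one_le₀ hk'
  have e1 : ((k + 1 : ℕ) : ℝ) ^ (2 * α) = (k : ℝ) ^ (2 * α) * ((1 + x) ^ α) ^ 2 := by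
    rw [← Real.rpow_natCast _ 2, ← Real.rpow_mul (by linarith), mul_comm α, Nat.cast_ofNat,
      ← Real.mul_rpow hk0.le (by linarith), hx]
    congr 1
    push_cast
    field_simp
  have e2 : ((k - 1 : ℕ) : ℝ) ^ (2 * α) = (k : ℝ) ^ (2 * α) * ((1 - x) ^ α) ^ 2 := by
    rw [← Real.rpow_natCast _ 2, ← Real.rpow_mul (by linarith), mul_comm α, Nat.cast_ofNat,
      ← Real.mul_rpow hk0.le (by linarith), hx]
    congr 1
    rw [Nat.cast_sub hk]
    push_cast
    field_simp
  have e3 : (k : ℝ) ^ (2 * α - 2) = (k : ℝ) ^ (2 * α) * x ^ 2 := by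
    rw [Real.rpow_sub hk0, hx, inv_pow, div_eq_mul_inv]
    norm_num
  have h1 : 1 + α * x ≤ (1 + x) ^ α := one_add_mul_self_le_rpow_one_add (by linarith) hα
  have h2 : (1 - x) ^ α ≤ 1 - x := by
    have := Real.rpow_le_rpow_of_exponent_ge' (x := 1 - x) (by linarith) (by linarith) zero_le_one hα
    rwa [Real.rpow_one] at this
  have h3 : 1 - α * x ^ 2 ≤ (1 + x) ^ α * (1 - x) ^ α := by
    rw [← Real.mul_rpow (by linarith) (by linarith)]
    have h4 := one_add_mul_self_le_rpow_one_add (s := -x ^ 2) (by nlinarith) hα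
    have h5 : (1 + x) * (1 - x) = 1 + -x ^ 2 := by ring
    rw [h5]
    linarith
  rw [e1, e2, e3]
  have hK : 0 ≤ (k : ℝ) ^ (2 * α) := Real.rpow_nonneg hk0.le _
  generalize (1 + x) ^ α = u at *
  generalize (1 - x) ^ α = v at *
  have h6 : (α + 1) * x ≤ u - v := by linarith
  have h7 : ((α + 1) * x) ^ 2 ≤ (u - v) ^ 2 := pow_le_pow_left₀ (by positivity) h6 2
  have h8 : α ^ 2 * x ^ 2 ≤ u ^ 2 + v ^ 2 - 2 := by nlinarith [sq_nonneg x]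
  nlinarith

theorem rpow_le_rpow_succ {α : ℝ} (hα : 1 ≤ α) (l : ℕ) :
    (l : ℝ) ^ (2 * α) ≤ ((l + 1 : ℕ) : ℝ) ^ (2 * α) :=
  Real.rpow_le_rpow (Nat.cast_nonneg l) (by push_cast; linarith) (by linarith)

theorem rpow_gap_monotone {α : ℝ} (hα : 1 ≤ α) :
    Monotone fun l : ℕ => ((l + 1 : ℕ) : ℝ) ^ (2 * α) - (l : ℝ) ^ (2 * α) := by
  refine monotone_nat_of_le_succ fun l => ?_
  have h := rpow_second_difference hα (k := l + 1) (by omega)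
  rw [Nat.add_sub_cancel] at h
  have : 0 ≤ α ^ 2 * ((l + 1 : ℕ) : ℝ) ^ (2 * α - 2) := by positivity
  linarith

theorem le_rpow_gap {α : ℝ} (hα : 1 ≤ α) {k : ℕ} (hk : 1 ≤ k) :
    α ^ 2 * (k : ℝ) ^ (2 * α - 2) ≤ ((k + 1 : ℕ) : ℝ) ^ (2 * α) - (k : ℝ) ^ (2 * α) := by
  have h1 := rpow_second_difference hα hk
  have h2 := rpow_le_rpow_succ hα (k - 1)
  rw [Nat.sub_add_cancel hk] at h2
  linarith

/-- Gaps increase, so the closest ones to the gap at `k` are its two neighbours, controlled by the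
second differences at `k` and `k + 1`. -/
theorem le_abs_rpow_gap_sub {α : ℝ} (hα : 1 ≤ α) {k l : ℕ} (hk : 1 ≤ k) (hl : l ≠ k) :
    α ^ 2 * (k : ℝ) ^ (2 * α - 2) ≤
      |(((l + 1 : ℕ) : ℝ) ^ (2 * α) - (l : ℝ) ^ (2 * α))
        - (((k + 1 : ℕ) : ℝ) ^ (2 * α) - (k : ℝ) ^ (2 * α))| := by
  have hmono := rpow_gap_monotone hα
  rcases lt_or_gt_of_ne hl with h | h
  · have h1 := hmono (show l ≤ k - 1 by omega)
    have h2 := rpow_second_difference hα hk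
    simp only at h1
    rw [Nat.sub_add_cancel hk] at h1
    rw [abs_sub_comm]
    exact le_trans (by linarith) (le_abs_self _)
  · have h1 := hmono (show k + 1 ≤ l by omega)
    have h2 := rpow_second_difference hα (k := k + 1) (by omega)
    rw [Nat.add_sub_cancel] at h2
    simp only at h1
    have h3 : (k : ℝ) ^ (2 * α - 2) ≤ ((k + 1 : ℕ) : ℝ) ^ (2 * α - 2) :=
      Real.rpow_le_rpow (Nat.cast_nonneg k) (by push_cast; linarith) (by linarith)
    have h4 := mul_le_mul_of_nonneg_left h3 (sq_nonneg α)
    exact le_trans (by linarith) (le_abs_self _)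

/-! ### Transfers between modes -/

theorem mode_mem_graph_drift (α : ℝ) (k : ℕ) :
    (mode k, (Complex.I * ((k : ℝ) ^ (2 * α) : ℝ)) • mode k) ∈ (drift α).graph := by
  rw [mem_graph_drift_iff]
  intro n
  have h := orthonormal_mode_succ
  have h1 : inner ℂ (modeBasis n) ((Complex.I * ((k : ℝ) ^ (2 * α) : ℝ)) • mode k)
      = Complex.I * ((k : ℝ) ^ (2 * α) : ℝ) * inner ℂ (modeBasis n) (mode k) :=
    inner_smul_right (𝕜 := ℂ) (modeBasis n) (mode k) _
  rw [h1, modeBasis_apply]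
  rcases k with _ | k
  · rw [mode_zero]; simp
  · rw [orthonormal_iff_ite.1 h n k]
    split_ifs with hnk
    · subst hnk; ring
    · ring

theorem approxSteers_pulse_mode {α : ℝ} (hα : 5 / 2 < α) {m k : ℕ} (hm : 2 ≤ m) (hmk : m ≤ k)
    {c : ℕ → ℂ} (hc : ∑ l ∈ Finset.Icc m (k + 1), ‖c l‖ ^ 2 ≤ 1) {T x : ℝ} (hT : 0 < T)
    (hx0 : 0 ≤ x) (hx1 : x ≤ π / 2) (φ : ℝ) :
    ApproxSteers (drift α) coupling T (64 / (T * (α ^ 2 * (k : ℝ) ^ (2 * α - 2))))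
      (∑ l ∈ Finset.Icc m (k + 1), c l • mode l)
      (∑ l ∈ Finset.Icc m (k + 1), (rotate k φ c x l
        * Complex.exp (((l : ℝ) ^ (2 * α) * T : ℝ) * Complex.I)) • mode l) := by
  have hk : 1 ≤ k := by omega
  have hk0 : (0 : ℝ) < k := by exact_mod_cast hk
  have hα0 : 0 < α := by linarith
  exact approxSteers_pulse (lam := fun l : ℕ => (l : ℝ) ^ (2 * α)) orthonormal_mode_succ
    (mode_mem_graph_drift α) (fun k hk => coupling_mode hk) norm_coupling_le
    (exists_isUnitaryGroupOf_drift_coupling (by linarith)) hm hmk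
    (by positivity) (rpow_le_rpow_succ (by linarith)) (le_rpow_gap (by linarith) hk)
    (fun l _ hl => le_abs_rpow_gap_sub (by linarith) hk hl) hc hT hx0 hx1 φ

/-- The angle is that of the point `(|c k|, |c (k+1)|)`, hence in the first quadrant; the phase
aligns `i exp(iφ) c k` with `c (k+1)` so that the two contributions cancel. -/
theorem exists_rotate_eq_zero (k : ℕ) (c : ℕ → ℂ) :
    ∃ x, 0 ≤ x ∧ x ≤ π / 2 ∧ ∃ φ, rotate k φ c x (k + 1) = 0 := by
  obtain ⟨z, hz⟩ : ∃ z : ℂ, z = ⟨‖c k‖, ‖c (k + 1)‖⟩ := ⟨_, rfl⟩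
  have hre : z.re = ‖c k‖ := by rw [hz]
  have him : z.im = ‖c (k + 1)‖ := by rw [hz]
  refine ⟨Complex.arg z, ?_, ?_, Complex.arg (c (k + 1)) - Complex.arg (c k) - π / 2, ?_⟩
  · rw [Complex.arg_nonneg_iff, him]; exact norm_nonneg _
  · refine (le_abs_self _).trans ?_
    rw [Complex.abs_arg_le_pi_div_two_iff, hre]; exact norm_nonneg _
  · have h1 : Real.cos (Complex.arg z) * ‖c (k + 1)‖ = Real.sin (Complex.arg z) * ‖c k‖ := by
      rw [← hre, ← him, ← Complex.norm_mul_cos_arg, ← Complex.norm_mul_sin_arg]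
      ring
    have h1' : ((Real.cos (Complex.arg z) : ℝ) : ℂ) * ‖c (k + 1)‖
        = ((Real.sin (Complex.arg z) : ℝ) : ℂ) * ‖c k‖ := by exact_mod_cast h1
    have h2 := Complex.norm_mul_exp_arg_mul_I (c k)
    have h3 := Complex.norm_mul_exp_arg_mul_I (c (k + 1))
    have h4 : Complex.I * Complex.exp (((Complex.arg (c (k + 1)) - Complex.arg (c k) - π / 2 : ℝ) : ℂ)
        * Complex.I) * Complex.exp (Complex.arg (c k) * Complex.I)
        = Complex.exp (Complex.arg (c (k + 1)) * Complex.I) := by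
      have h5 : Complex.I = Complex.exp (π / 2 * Complex.I) := by
        rw [Complex.exp_pi_div_two_mul_I]
      nth_rewrite 1 [h5]
      rw [← Complex.exp_add, ← Complex.exp_add]
      push_cast
      ring_nf
    rw [rotate_succ]
    linear_combination Complex.exp (Complex.arg (c (k + 1)) * Complex.I) * h1'
      - ((Real.sin (Complex.arg z) : ℝ) : ℂ) * ‖c k‖ * h4
      - ((Real.cos (Complex.arg z) : ℝ) : ℂ) * h3
      + Complex.I * Complex.exp (((Complex.arg (c (k + 1)) - Complex.arg (c k) - π / 2 : ℝ) : ℂ)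
        * Complex.I) * ((Real.sin (Complex.arg z) : ℝ) : ℂ) * h2

/-- Adding `π` to the phase changes the sign of the off-diagonal entries, so it inverts the rotation
while keeping the angle nonnegative, as pulses require. -/
theorem rotate_add_pi_rotate (k : ℕ) (φ : ℝ) (c : ℕ → ℂ) (x : ℝ) (l : ℕ) :
    rotate k (φ + π) (rotate k φ c x) x l = c l := by
  have h1 : Complex.exp (-φ * Complex.I) * Complex.exp (φ * Complex.I) = 1 := by
    rw [← Complex.exp_add]; simp
  have h2 : ((Real.cos x : ℝ) : ℂ) ^ 2 + ((Real.sin x : ℝ) : ℂ) ^ 2 = 1 := by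
    exact_mod_cast Real.cos_sq_add_sin_sq x
  have h3 : Complex.exp (((φ + π : ℝ) : ℂ) * Complex.I) = -Complex.exp (φ * Complex.I) := by
    push_cast
    rw [add_mul, Complex.exp_add, Complex.exp_pi_mul_I]
    ring
  have h4 : Complex.exp (-((φ + π : ℝ) : ℂ) * Complex.I) = -Complex.exp (-φ * Complex.I) := by
    push_cast
    rw [neg_add, add_mul, Complex.exp_add, neg_mul (π : ℂ), Complex.exp_neg, Complex.exp_pi_mul_I]
    norm_num
  rcases eq_or_ne l k with rfl | hk
  · rw [rotate_self, rotate_self, rotate_succ, h4]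
    linear_combination c l * (h2 + ((Real.sin x : ℝ) : ℂ) ^ 2 * h1
      - ((Real.sin x : ℝ) : ℂ) ^ 2 * Complex.exp (-φ * Complex.I) * Complex.exp (φ * Complex.I)
        * Complex.I_sq)
  · rcases eq_or_ne l (k + 1) with rfl | hk'
    · rw [rotate_succ, rotate_self, rotate_succ, h3]
      linear_combination c (k + 1) * (h2 + ((Real.sin x : ℝ) : ℂ) ^ 2 * h1
        - ((Real.sin x : ℝ) : ℂ) ^ 2 * Complex.exp (-φ * Complex.I) * Complex.exp (φ * Complex.I)
          * Complex.I_sq)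
    · rw [rotate_of_ne _ _ _ hk hk', rotate_of_ne _ _ _ hk hk']

theorem sum_Icc_succ_of_eq_zero {M : Type*} [AddCommMonoid M] {m k : ℕ} (hmk : m ≤ k) (f : ℕ → M)
    (hf : f (k + 1) = 0) : ∑ l ∈ Finset.Icc m (k + 1), f l = ∑ l ∈ Finset.Icc m k, f l := by
  rw [← Finset.sum_Ioc_add_eq_sum_Icc (by omega : m ≤ k + 1), ← Finset.sum_Ioc_add_eq_sum_Icc hmk,
    Finset.sum_Ioc_succ_top hmk, hf, add_zero]

theorem exists_approxSteers_lower {α : ℝ} (hα : 5 / 2 < α) {m k : ℕ} (hm : 2 ≤ m) (hmk : m ≤ k)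
    {c : ℕ → ℂ} (hc : ∑ l ∈ Finset.Icc m (k + 1), ‖c l‖ ^ 2 = 1) {T : ℝ} (hT : 0 < T) :
    ∃ c' : ℕ → ℂ, ∑ l ∈ Finset.Icc m k, ‖c' l‖ ^ 2 = 1 ∧
      ApproxSteers (drift α) coupling T (64 / (T * (α ^ 2 * (k : ℝ) ^ (2 * α - 2))))
        (∑ l ∈ Finset.Icc m (k + 1), c l • mode l) (∑ l ∈ Finset.Icc m k, c' l • mode l) := by
  obtain ⟨x, hx0, hx1, φ, h0⟩ := exists_rotate_eq_zero k c
  have h := approxSteers_pulse_mode hα hm hmk hc.le hT hx0 hx1 φ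
  rw [sum_Icc_succ_of_eq_zero hmk (fun l => (rotate k φ c x l
    * Complex.exp (((l : ℝ) ^ (2 * α) * T : ℝ) * Complex.I)) • mode l)
    (by rw [h0, zero_mul, zero_smul])] at h
  refine ⟨_, ?_, h⟩
  rw [← hc, ← sum_norm_sq_rotate hmk φ c x,
    sum_Icc_succ_of_eq_zero hmk (fun l => ‖rotate k φ c x l‖ ^ 2) (by simp [h0])]
  refine Finset.sum_congr rfl fun l _ => ?_
  rw [norm_mul, Complex.norm_exp_ofReal_mul_I, mul_one]

/-- The free phases that the pulse will add are removed from the target beforehand, giving `d`. The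
start is `d` rotated so that its top coordinate vanishes, and the pulse undoes that rotation. -/
theorem exists_approxSteers_raise {α : ℝ} (hα : 5 / 2 < α) {m k : ℕ} (hm : 2 ≤ m) (hmk : m ≤ k)
    {c : ℕ → ℂ} (hc : ∑ l ∈ Finset.Icc m (k + 1), ‖c l‖ ^ 2 = 1) {T : ℝ} (hT : 0 < T) :
    ∃ c' : ℕ → ℂ, ∑ l ∈ Finset.Icc m k, ‖c' l‖ ^ 2 = 1 ∧
      ApproxSteers (drift α) coupling T (64 / (T * (α ^ 2 * (k : ℝ) ^ (2 * α - 2))))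
        (∑ l ∈ Finset.Icc m k, c' l • mode l) (∑ l ∈ Finset.Icc m (k + 1), c l • mode l) := by
  obtain ⟨d, hd⟩ : ∃ d : ℕ → ℂ, d = fun l =>
    c l * Complex.exp ((-((l : ℝ) ^ (2 * α) * T) : ℝ) * Complex.I) := ⟨_, rfl⟩
  have hdn : ∑ l ∈ Finset.Icc m (k + 1), ‖d l‖ ^ 2 = 1 := by
    rw [← hc]
    refine Finset.sum_congr rfl fun l _ => ?_
    rw [hd]
    simp only
    rw [norm_mul, Complex.norm_exp_ofReal_mul_I, mul_one]
  obtain ⟨x, hx0, hx1, φ, h0⟩ := exists_rotate_eq_zero k d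
  have hn := (sum_norm_sq_rotate hmk φ d x).trans hdn
  have h := approxSteers_pulse_mode hα hm hmk hn.le hT hx0 hx1 (φ + π)
  rw [sum_Icc_succ_of_eq_zero hmk (fun l => rotate k φ d x l • mode l)
    (by rw [h0, zero_smul])] at h
  rw [sum_Icc_succ_of_eq_zero hmk (fun l => ‖rotate k φ d x l‖ ^ 2) (by simp [h0])] at hn
  refine ⟨rotate k φ d x, hn, ?_⟩
  have h2 : ∀ l, rotate k (φ + π) (rotate k φ d x) x l
      * Complex.exp (((l : ℝ) ^ (2 * α) * T : ℝ) * Complex.I) = c l := by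
    intro l
    rw [rotate_add_pi_rotate, hd]
    simp only
    rw [mul_assoc, ← Complex.exp_add, ← add_mul, ← Complex.ofReal_add, neg_add_cancel]
    simp
  simpa only [h2] using h

/-- Each pulse lowers the top index by one. The final phase `z` is not controlled;
`exists_approxSteers_phase` corrects it. -/
theorem exists_approxSteers_sweep_down {α : ℝ} (hα : 5 / 2 < α) {m : ℕ} (hm : 2 ≤ m) {τ : ℕ → ℝ}
    (hτ : ∀ k, m ≤ k → 0 < τ k) (j : ℕ) {c : ℕ → ℂ}
    (hc : ∑ l ∈ Finset.Icc m (m + j), ‖c l‖ ^ 2 = 1) :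
    ∃ z : ℂ, ‖z‖ = 1 ∧ ApproxSteers (drift α) coupling (∑ i ∈ Finset.range j, τ (m + i))
      (∑ i ∈ Finset.range j, 64 / (τ (m + i) * (α ^ 2 * ((m + i : ℕ) : ℝ) ^ (2 * α - 2))))
      (∑ l ∈ Finset.Icc m (m + j), c l • mode l) (z • mode m) := by
  induction j generalizing c with
  | zero =>
    rw [add_zero, Finset.Icc_self, Finset.sum_singleton] at hc ⊢
    refine ⟨c m, ?_, ApproxSteers.refl _⟩
    exact (pow_eq_one_iff_of_nonneg (norm_nonneg _) two_ne_zero).1 hc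
  | succ j ih =>
    obtain ⟨c', hc', h1⟩ := exists_approxSteers_lower hα hm (by omega : m ≤ m + j) hc
      (hτ (m + j) (by omega))
    obtain ⟨z, hz, h2⟩ := ih hc'
    refine ⟨z, hz, ?_⟩
    rw [Finset.sum_range_succ, Finset.sum_range_succ, add_comm _ (τ _), add_comm _ (64 / _)]
    exact h1.trans h2

theorem exists_approxSteers_sweep_up {α : ℝ} (hα : 5 / 2 < α) {m : ℕ} (hm : 2 ≤ m) {τ : ℕ → ℝ}
    (hτ : ∀ k, m ≤ k → 0 < τ k) (j : ℕ) {c : ℕ → ℂ}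
    (hc : ∑ l ∈ Finset.Icc m (m + j), ‖c l‖ ^ 2 = 1) :
    ∃ z : ℂ, ‖z‖ = 1 ∧ ApproxSteers (drift α) coupling (∑ i ∈ Finset.range j, τ (m + i))
      (∑ i ∈ Finset.range j, 64 / (τ (m + i) * (α ^ 2 * ((m + i : ℕ) : ℝ) ^ (2 * α - 2))))
      (z • mode m) (∑ l ∈ Finset.Icc m (m + j), c l • mode l) := by
  induction j generalizing c with
  | zero =>
    rw [add_zero, Finset.Icc_self, Finset.sum_singleton] at hc ⊢
    refine ⟨c m, ?_, ApproxSteers.refl _⟩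
    exact (pow_eq_one_iff_of_nonneg (norm_nonneg _) two_ne_zero).1 hc
  | succ j ih =>
    obtain ⟨c', hc', h1⟩ := exists_approxSteers_raise hα hm (by omega : m ≤ m + j) hc
      (hτ (m + j) (by omega))
    obtain ⟨z, hz, h2⟩ := ih hc'
    refine ⟨z, hz, ?_⟩
    rw [Finset.sum_range_succ, Finset.sum_range_succ]
    exact h2.trans h1

theorem exists_approxSteers_phase {α : ℝ} (hα : 5 / 2 < α) {m : ℕ} (hm : 1 ≤ m) {z z' : ℂ}
    (hz : ‖z‖ = 1) (hz' : ‖z'‖ = 1) :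
    ∃ T, 0 < T ∧ T ≤ 2 * π / (m : ℝ) ^ (2 * α) ∧
      ApproxSteers (drift α) coupling T 0 (z • mode m) (z' • mode m) := by
  have hm0 : (0 : ℝ) < m := by exact_mod_cast hm
  obtain ⟨lam, hlam⟩ : ∃ lam : ℝ, lam = (m : ℝ) ^ (2 * α) := ⟨_, rfl⟩
  have hlam0 : 0 < lam := by rw [hlam]; positivity
  have hz0 : z ≠ 0 := fun h => by simp [h] at hz
  -- The angle is taken in `(0, 2π]` and not in `[0, 2π)`: the duration must be positive, also when
  -- no pulse is needed because `P = N₀`.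
  obtain ⟨x, hx0, hx1, hx⟩ : ∃ x : ℝ, 0 < x ∧ x ≤ 2 * π ∧ z' = z * Complex.exp (x * Complex.I) := by
    have h1 := Complex.norm_mul_exp_arg_mul_I (z' / z)
    rw [norm_div, hz, hz', div_one, Complex.ofReal_one, one_mul, eq_div_iff hz0, mul_comm] at h1
    have h2 := Complex.neg_pi_lt_arg (z' / z)
    have h3 := Complex.arg_le_pi (z' / z)
    rcases lt_or_ge 0 (Complex.arg (z' / z)) with h | h
    · exact ⟨_, h, by linarith [Real.pi_pos], h1.symm⟩
    · refine ⟨Complex.arg (z' / z) + 2 * π, by linarith, by linarith, ?_⟩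
      push_cast
      rw [add_mul, Complex.exp_add, Complex.exp_two_pi_mul_I, mul_one, h1]
  refine ⟨x / lam, by positivity, ?_, ?_⟩
  · rw [← hlam]
    exact div_le_div_of_nonneg_right hx1 hlam0.le
  · have hn : ‖mode m‖ = 1 := by
      have : ‖mode (m - 1 + 1)‖ = 1 := orthonormal_mode_succ.1 (m - 1)
      rwa [Nat.sub_add_cancel hm] at this
    have h := approxSteers_of_approx (A := drift α) (B := coupling) (T := x / lam) (η := 0) (K := 0)
      (M := 1) (exists_isUnitaryGroupOf_drift_coupling (by linarith)) norm_coupling_le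
      (by positivity)
      (q := fun t : ℝ => (z * Complex.exp ((lam * t + 0 : ℝ) * Complex.I)) • mode m)
      (q' := fun t : ℝ => (z * (Complex.I * lam * Complex.exp ((lam * t + 0 : ℝ) * Complex.I)))
        • mode m)
      (a := fun t : ℝ => (z * (Complex.I * lam * Complex.exp ((lam * t + 0 : ℝ) * Complex.I)))
        • mode m)
      (u := fun _ => 0) (by simp)
      (fun t => by
        rw [norm_smul, norm_mul, hz, hn, Complex.norm_exp_ofReal_mul_I, one_mul, one_mul])
      (fun t => ((hasDerivAt_exp_mul_I lam 0 t).const_mul z).smul_const _)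
      (fun t => by
        have := (drift α).graph.smul_mem (z * Complex.exp ((lam * t + 0 : ℝ) * Complex.I))
          (mode_mem_graph_drift α m)
        rw [Prod.smul_mk, smul_smul, ← hlam] at this
        convert this using 3
        ring)
      (fun t => by simp)
    have e1 : z * Complex.exp ((lam * 0 + 0 : ℝ) * Complex.I) = z := by simp
    have e2 : z * Complex.exp ((lam * (x / lam) + 0 : ℝ) * Complex.I) = z' := by
      rw [hx, add_zero, mul_div_cancel₀ _ hlam0.ne']
    simp only [e1, e2, zero_mul] at h
    exact h

theorem exists_sum_mode_of_mem {N P : ℕ} (hN : 1 ≤ N) {ψ : Hodd}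
    (hψ : ψ ∈ modeSpan P ⊓ (modeSpan (N - 1))ᗮ) :
    ∃ c : ℕ → ℂ, ψ = ∑ l ∈ Finset.Icc N P, c l • mode l := by
  obtain ⟨h1, h2⟩ := Submodule.mem_inf.1 hψ
  have hcoe : (Set.Icc 1 P : Set ℕ) = ((Finset.Icc 1 P : Finset ℕ) : Set ℕ) := by simp
  rw [modeSpan, hcoe, Submodule.mem_span_image_finset_iff_exists_fun'] at h1
  obtain ⟨c, hc⟩ := h1
  refine ⟨c, ?_⟩
  rw [← hc]
  symm
  refine Finset.sum_subset (fun l hl => ?_) fun l hl hl' => ?_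
  · rw [Finset.mem_Icc] at hl ⊢; omega
  · rw [Finset.mem_Icc] at hl hl'
    have h3 : inner ℂ (mode l) ψ = 0 := (Submodule.mem_orthogonal _ _).1 h2 _
      (Submodule.subset_span ⟨l, ⟨hl.1, by omega⟩, rfl⟩)
    have h4 : ∀ j ∈ Finset.Icc 1 P, inner ℂ (mode l) (c j • mode j)
        = if j = l then c l else 0 := by
      intro j hj
      rw [Finset.mem_Icc] at hj
      have h5 := orthonormal_iff_ite.1 orthonormal_mode_succ (l - 1) (j - 1)
      rw [Nat.sub_add_cancel hl.1, Nat.sub_add_cancel hj.1] at h5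
      have h6 : inner ℂ (mode l) (c j • mode j) = c j * inner ℂ (mode l) (mode j) :=
        inner_smul_right (𝕜 := ℂ) (mode l) (mode j) (c j)
      rw [h6, h5]
      by_cases h : j = l
      · subst h; simp
      · rw [if_neg (by omega), if_neg h, mul_zero]
    rw [← hc, inner_sum, Finset.sum_congr rfl h4, Finset.sum_ite_eq', if_pos (by
      rw [Finset.mem_Icc]; exact hl)] at h3
    rw [h3, zero_smul]

theorem sum_norm_sq_eq_one {N P : ℕ} (hN : 1 ≤ N) {c : ℕ → ℂ}
    (h : ‖∑ l ∈ Finset.Icc N P, c l • mode l‖ = 1) : ∑ l ∈ Finset.Icc N P, ‖c l‖ ^ 2 = 1 := by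
  rw [← norm_sq_sum_smul orthonormal_mode_succ (Finset.Icc N P) (fun l => l)
    (fun a _ b _ h => h) (fun l hl => by rw [Finset.mem_Icc] at hl; omega) c, h, one_pow]

end TorusControl

theorem mainTheorem2 (α : ℝ) (hα : 5 / 2 < α) :
    ∃ Nmin : ℕ, ∀ N₀ : ℕ, Nmin ≤ N₀ → ∀ P : ℕ, N₀ ≤ P →
      ∀ ψ₀ ψ₁ : TorusControl.Hodd,
        ψ₀ ∈ TorusControl.modeSpan P ⊓ (TorusControl.modeSpan (N₀ - 1))ᗮ →
        ψ₁ ∈ TorusControl.modeSpan P ⊓ (TorusControl.modeSpan (N₀ - 1))ᗮ →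
        ‖ψ₀‖ = 1 → ‖ψ₁‖ = 1 →
        ∀ ε : ℝ, 0 < ε →
          ∃ T : ℝ, 0 < T ∧
            T < 604 / (α ^ 2 * ε * (2 * α - 5)) * (1 / ((N₀ : ℝ) - 1) ^ (2 * α - 4))
              + 2 * π / (N₀ : ℝ) ^ (2 * α) ∧
            ∃ ψ ∈ TorusControl.reachableSet (TorusControl.drift α) TorusControl.coupling T ψ₀,
              ‖ψ - ψ₁‖ < ε := by
  -- With `N₀ ≥ 2` the mode below the lowest one is nonzero and `N₀ - 1` is positive.
  refine ⟨2, fun m hm P hP ψ₀ ψ₁ h₀ h₁ hn₀ hn₁ ε hε => ?_⟩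
  obtain ⟨j, rfl⟩ : ∃ j, P = m + j := ⟨P - m, by omega⟩
  obtain ⟨c, rfl⟩ := TorusControl.exists_sum_mode_of_mem (by omega) h₀
  obtain ⟨d, rfl⟩ := TorusControl.exists_sum_mode_of_mem (by omega) h₁
  have hm' : (2 : ℝ) ≤ m := by exact_mod_cast hm
  have hm1 : (0 : ℝ) < (m : ℝ) - 1 := by linarith
  have hα0 : 0 < α := by linarith
  have hα1 : 0 < 2 * α - 5 := by linarith
  -- Chosen so that each sweep costs an error at most `64ε/130`, which leaves `2ε/130` to spare over
  -- the two sweeps.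
  obtain ⟨κ, hκ⟩ : ∃ κ : ℝ, κ = 130 / (ε * α ^ 2 * ((m : ℝ) - 1)) := ⟨_, rfl⟩
  have hκ0 : 0 < κ := by rw [hκ]; positivity
  -- The exponent `-(2α-4)` makes `τ k` times the gap `k^(2α-2)` grow like `k²`, so that the errors
  -- are summable.
  obtain ⟨τ, hτ⟩ : ∃ τ : ℕ → ℝ, τ = fun k : ℕ => κ * (k : ℝ) ^ (-((2 * α - 5) + 1)) := ⟨_, rfl⟩
  have hτ0 : ∀ k, m ≤ k → 0 < τ k := by
    intro k hk
    have : (0 : ℝ) < k := by exact_mod_cast (by omega : 0 < k)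
    rw [hτ]
    positivity
  obtain ⟨z, hz, hdown⟩ := TorusControl.exists_approxSteers_sweep_down hα hm hτ0 j
    (TorusControl.sum_norm_sq_eq_one (by omega) hn₀)
  obtain ⟨z', hz', hup⟩ := TorusControl.exists_approxSteers_sweep_up hα hm hτ0 j
    (TorusControl.sum_norm_sq_eq_one (by omega) hn₁)
  obtain ⟨t, ht0, ht1, hphase⟩ :=
    TorusControl.exists_approxSteers_phase hα (by omega : 1 ≤ m) hz hz'
  have hE : ∑ i ∈ Finset.range j,
      64 / (τ (m + i) * (α ^ 2 * ((m + i : ℕ) : ℝ) ^ (2 * α - 2))) ≤ 64 / 130 * ε := by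
    have h1 : ∀ i ∈ Finset.range j, 64 / (τ (m + i) * (α ^ 2 * ((m + i : ℕ) : ℝ) ^ (2 * α - 2)))
        = 64 / (κ * α ^ 2) * ((m + i : ℕ) : ℝ) ^ (-((1 : ℝ) + 1)) := by
      intro i _
      have hpos : (0 : ℝ) < ((m + i : ℕ) : ℝ) := by exact_mod_cast (by omega : 0 < m + i)
      rw [hτ, Real.rpow_neg hpos.le ((1 : ℝ) + 1)]
      simp only
      have h2 : ((m + i : ℕ) : ℝ) ^ ((1 : ℝ) + 1)
          = ((m + i : ℕ) : ℝ) ^ (-((2 * α - 5) + 1)) * ((m + i : ℕ) : ℝ) ^ (2 * α - 2) := by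
        rw [← Real.rpow_add hpos]
        ring_nf
      rw [h2]
      field_simp
    rw [Finset.sum_congr rfl h1, ← Finset.mul_sum]
    refine (mul_le_mul_of_nonneg_left (TorusControl.sum_rpow_le hm one_pos j)
      (by positivity)).trans (le_of_eq ?_)
    rw [Real.rpow_neg_one, hκ]
    field_simp
  have hS : ∑ i ∈ Finset.range j, τ (m + i)
      ≤ 130 / (α ^ 2 * ε * (2 * α - 5)) * (1 / ((m : ℝ) - 1) ^ (2 * α - 4)) := by
    rw [hτ]
    simp only
    rw [← Finset.mul_sum]
    refine (mul_le_mul_of_nonneg_left (TorusControl.sum_rpow_le hm hα1 j) hκ0.le).trans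
      (le_of_eq ?_)
    have h2 : ((m : ℝ) - 1) ^ (-(2 * α - 5)) = ((m : ℝ) - 1) * (1 / ((m : ℝ) - 1) ^ (2 * α - 4)) := by
      rw [one_div, ← Real.rpow_neg hm1.le]
      nth_rewrite 2 [← Real.rpow_one ((m : ℝ) - 1)]
      rw [← Real.rpow_add hm1]
      ring_nf
    rw [h2, hκ]
    field_simp
  have hS0 : 0 ≤ ∑ i ∈ Finset.range j, τ (m + i) :=
    Finset.sum_nonneg fun i _ => (hτ0 (m + i) (by omega)).le
  -- The total error is at most `(64 + 64 + 1)ε/130 < ε`.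
  obtain ⟨u, χ, hu, hsteer, hχ⟩ := ((hdown.trans hphase).trans hup) (ε / 130) (by positivity)
  refine ⟨_, ?_, ?_, χ, ⟨u, hu, hsteer⟩, ?_⟩
  · linarith
  -- The two sweeps use the constant `2 · 130 = 260`, less than `604`.
  · have hb : 0 < 1 / (α ^ 2 * ε * (2 * α - 5)) * (1 / ((m : ℝ) - 1) ^ (2 * α - 4)) := by
      positivity
    have e1 : ∀ x : ℝ, x / (α ^ 2 * ε * (2 * α - 5)) * (1 / ((m : ℝ) - 1) ^ (2 * α - 4))
        = x * (1 / (α ^ 2 * ε * (2 * α - 5)) * (1 / ((m : ℝ) - 1) ^ (2 * α - 4))) := by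
      intro x; ring
    rw [e1] at hS ⊢
    linarith
  · linarith
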